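/- Let $V$ be a real vector space of finite dimension $d\ge 1$, let $L\subset V$ be a lattice (a discrete subgroup spanning $V$), and let $L^*=\{y\in V^* : y(L)\subseteq\mathbb Z\}$ be the dual lattice. A polytope is the convex hull of a finite nonempty set of points; it is a lattice polytope if all its vertices are lattice points. A reflexive polytope in $V$ is a lattice polytope $P\subset V$ (with respect to $L$) that contains $0$ in its interior, whose vertices are primitive lattice points, and whose dual $P^*=\{y\in V^* : y(x)\ge -1 \text{ for all } x\in P\}$ is a lattice polytope with respect to $L^*$. Two polytopes are combinatorially isomorphic if their face lattices (all faces, ordered by inclusion) are isomorphic. Then: 1. There are reflexive polytopes in $V$ that are combinatorially isomorphic to the $d$-simplex, to the $d$-cube $[-1,1]^d$, and to the $d$-crosspolytope $\operatorname{conv}(\pm e_1,\dots,\pm e_d)$, respectively. 2. If $d=3$, no reflexive polytope in $V$ is combinatorially isomorphic to the regular dodecahedron, and none is combinatorially isomorphic to the regular icosahedron. 3. If $d=4$, no reflexive polytope in $V$ is combinatorially isomorphic to the regular 120-cell, and none is combinatorially isomorphic to the regular 600-cell. Here, with $\varphi=(1+\sqrt5)/2$, the regular icosahedron is the convex hull of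 the 12 even permutations of $(0,\pm1,\pm\varphi)$ in $\mathbb R^3$; the regular 600-cell is the convex hull of the 120 points of $\mathbb R^4$ consisting of the permutations of $(\pm2,0,0,0)$, the points $(\pm1,\pm1,\pm1,\pm1)$ and the even permutations of $(\pm\varphi,\pm1,\pm\varphi^{-1},0)$; and the regular dodecahedron and the regular 120-cell are their respective polars $\{x : \langle x,v\rangle\le 1 \text{ for all vertices } v\}$. -/

import Mathlib

/-! Lattices are `ℤ`-lattices `L` (discrete subgroups spanning the space) in a finite-dimensional
real vector space `V`; the dual lattice lives in the dual space. -/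

/-- A polytope is the convex hull of finitely many (at least one) points. -/
def IsPolytope {V : Type*} [AddCommGroup V] [Module ℝ V] (P : Set V) : Prop :=
  ∃ S : Set V, S.Finite ∧ S.Nonempty ∧ P = convexHull ℝ S

/-- A lattice polytope with respect to `L`: a polytope all of whose vertices lie in `L`. -/
def IsLatticePolytope {V : Type*} [AddCommGroup V] [Module ℝ V] (L : Submodule ℤ V)
    (P : Set V) : Prop :=
  IsPolytope P ∧ P.extremePoints ℝ ⊆ (L : Set V)

/-- A primitive lattice point: a non-zero lattice point that is not a proper multiple of
another lattice point. -/
def IsPrimitiveLatticePoint {V : Type*} [AddCommGroup V] (L : Submodule ℤ V) (v : V) : Prop :=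
  v ∈ L ∧ v ≠ 0 ∧ ∀ w ∈ L, ∀ n : ℕ, v = n • w → n = 1

/-- The dual lattice `Hom(L, ℤ)`, as the linear forms on `V` that are integral on `L`. -/
def dualLattice {V : Type*} [AddCommGroup V] [Module ℝ V] (L : Submodule ℤ V) :
    Submodule ℤ (Module.Dual ℝ V) where
  carrier := {y | ∀ x ∈ L, ∃ n : ℤ, y x = n}
  zero_mem' := fun _ _ => ⟨0, by simp⟩
  add_mem' := by
    intro a b ha hb x hx
    obtain ⟨m, hm⟩ := ha x hx
    obtain ⟨n, hn⟩ := hb x hx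
    exact ⟨m + n, by simp [hm, hn]⟩
  smul_mem' := by
    intro c a ha x hx
    obtain ⟨m, hm⟩ := ha x hx
    exact ⟨c * m, by simp [hm]⟩

/-- The dual polytope `P* = {y : ⟨x, y⟩ ≥ -1 for all x ∈ P}`, in the dual space. -/
def dualPolytope {V : Type*} [AddCommGroup V] [Module ℝ V] (P : Set V) :
    Set (Module.Dual ℝ V) :=
  {y | ∀ x ∈ P, -1 ≤ y x}

/-- A Fano polytope: a (full-dimensional) lattice polytope with the origin in its interior
whose vertices are primitive lattice points. -/
structure IsFanoPolytope {V : Type*} [NormedAddCommGroup V] [NormedSpace ℝ V]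
    (L : Submodule ℤ V) (P : Set V) : Prop where
  isLatticePolytope : IsLatticePolytope L P
  zero_mem_interior : (0 : V) ∈ interior P
  primitive : ∀ v ∈ P.extremePoints ℝ, IsPrimitiveLatticePoint L v

/-- A reflexive polytope: a Fano polytope whose dual is a lattice polytope (with respect to the
dual lattice). -/
structure IsReflexivePolytope {V : Type*} [NormedAddCommGroup V] [NormedSpace ℝ V]
    (L : Submodule ℤ V) (P : Set V) : Prop where
  isFanoPolytope : IsFanoPolytope L P
  dual_isLatticePolytope : IsLatticePolytope (dualLattice L) (dualPolytope P)

/-- The faces of `P`, ordered by inclusion: `∅`, and the sets where a linear form attains its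
maximum over `P` (the zero form gives `P` itself). -/
abbrev PolytopeFace {V : Type*} [AddCommGroup V] [Module ℝ V] [TopologicalSpace V]
    (P : Set V) : Type _ :=
  {F : Set V // IsExposed ℝ P F}

/-- Combinatorial isomorphism: an isomorphism of the face lattices. -/
def CombinatoriallyIsomorphic {V W : Type*} [AddCommGroup V] [Module ℝ V] [TopologicalSpace V]
    [AddCommGroup W] [Module ℝ W] [TopologicalSpace W] (P : Set V) (Q : Set W) : Prop :=
  Nonempty (PolytopeFace P ≃o PolytopeFace Q)

/-- The standard `d`-simplex, the convex hull of the unit vectors of `ℝ^(d+1)`. -/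
def simplexPolytope (d : ℕ) : Set (Fin (d + 1) → ℝ) :=
  stdSimplex ℝ (Fin (d + 1))

/-- The `d`-cube `[-1, 1]^d`. -/
def cubePolytope (d : ℕ) : Set (Fin d → ℝ) :=
  Set.Icc (fun _ => -1) (fun _ => 1)

/-- The `d`-crosspolytope, the convex hull of `±e₁, …, ±e_d`. -/
def crossPolytope (d : ℕ) : Set (Fin d → ℝ) :=
  convexHull ℝ ({x | ∃ i, x = Pi.single i 1} ∪ {x | ∃ i, x = -Pi.single i 1})

/-- All points obtained from `a` by an even permutation of the coordinates and arbitrary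
changes of signs. -/
def evenSignedPermutations {n : ℕ} (a : Fin n → ℝ) : Set (Fin n → ℝ) :=
  {x | ∃ σ ∈ alternatingGroup (Fin n), ∃ s : Fin n → ℝ,
    (∀ i, s i = 1 ∨ s i = -1) ∧ x = fun i => s i * a (σ i)}

/-- The polar `{x : ⟨x, y⟩ ≤ 1 for all y ∈ S}` in Euclidean space. -/
def euclideanPolar {n : ℕ} (S : Set (Fin n → ℝ)) : Set (Fin n → ℝ) :=
  {x | ∀ y ∈ S, x ⬝ᵥ y ≤ 1}

/-- The 12 vertices `(0, ±1, ±φ)`, `(±1, ±φ, 0)`, `(±φ, 0, ±1)` of a regular icosahedron, with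
`φ` the golden ratio. -/
noncomputable def icosahedronVertices : Set (Fin 3 → ℝ) :=
  evenSignedPermutations ![0, 1, Real.goldenRatio]

/-- The regular icosahedron. -/
noncomputable def icosahedron : Set (Fin 3 → ℝ) :=
  convexHull ℝ icosahedronVertices

/-- The regular dodecahedron, as the reciprocal of the regular icosahedron: the intersection of
the 12 half-spaces `⟨x, v⟩ ≤ 1`, `v` a vertex of the icosahedron. -/
noncomputable def dodecahedron : Set (Fin 3 → ℝ) :=
  euclideanPolar icosahedronVertices

/-- The 120 vertices of a regular 600-cell (of circumradius 2): the 8 points `(±2, 0, 0, 0)`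
with permutations, the 16 points `(±1, ±1, ±1, ±1)`, and the 96 even permutations of
`(±φ, ±1, ±φ⁻¹, 0)`. -/
noncomputable def cell600Vertices : Set (Fin 4 → ℝ) :=
  evenSignedPermutations ![2, 0, 0, 0] ∪ evenSignedPermutations ![1, 1, 1, 1] ∪
    evenSignedPermutations ![Real.goldenRatio, 1, Real.goldenRatio⁻¹, 0]

/-- The regular 600-cell. -/
noncomputable def cell600 : Set (Fin 4 → ℝ) :=
  convexHull ℝ cell600Vertices

/-- The regular 120-cell, as the reciprocal of the regular 600-cell: the intersection of the
120 half-spaces `⟨x, v⟩ ≤ 1`, `v` a vertex of the 600-cell. -/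
noncomputable def cell120 : Set (Fin 4 → ℝ) :=
  euclideanPolar cell600Vertices

/-! The non-existence results rest on one bound: a simplicial reflexive `d`-polytope has at most
`3d` vertices. Let `A` be the vertices of `P` and `B` those of the dual, one for each facet. Every
`u a` is an integer at least `-1`, and `u a = -1` means that `a` lies on the facet of `u`. If that
facet is a simplex, its vertices form a basis of `V`. A vertex `x` with `u x = 0` has a negative
coordinate at some `b i`, and integrality then puts `x` on the facet adjacent across `b i`. That
facet is a simplex as well, so each `i` serves only one `x`, and at most `d` vertices have height
zero (`card_height_zero_le`). If `A` had more than `3d` elements, then `∑ u a ≥ |A| - 2d - d > 0`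
for every `u`. The sum of the vertices would span a ray inside the bounded polytope `P`, which is
absurd (`card_le_three_mul`). The conditions on `A` and `B` are symmetric, so a simple reflexive
polytope has at most `3d` facets.

The number of atoms, and a bound on the number of atoms below a non-maximal element, depend only on
the order of the face lattice; the opposite order yields the same for facets. It remains to see that
the icosahedron (12 > 9 vertices) and the 600-cell (120 > 12) are simplicial; their polars are then
simple, with as many facets. No list of facets is needed. For two non-adjacent vertices, a multiple
of the sum is a sum of so few vertices that no proper face contains both. The vertices on a proper
face thus have equal pairwise inner products and are linearly independent
(`IsSimplicialSystem.card_filter_le`). The relations are checked by integer arithmetic in `ℤ[φ]`.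

For existence, a basis of `L` reduces everything to integral polar pairs in `ℝ^d`: the cube and the
crosspolytope, and the simplex on `e_1, …, e_d, -∑ e_i` with its polar. -/

/-! ### The bound `3d` for simplicial reflexive polytopes -/

/-- `A` is a set of vectors and `B` a set of linear forms, integral and at least `-1` on `A`,
such that the forms in `B` are the vertices of `{y | ∀ a ∈ A, -1 ≤ y a}`. -/
structure IsReflexivePair {V : Type*} [AddCommGroup V] [Module ℝ V] (A : Finset V)
    (B : Finset (Module.Dual ℝ V)) : Prop where
  int : ∀ u ∈ B, ∀ a ∈ A, ∃ n : ℤ, u a = n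
  ge : ∀ u ∈ B, ∀ a ∈ A, -1 ≤ u a
  zero_notMem : (0 : V) ∉ A
  separating : ∀ u ∈ B, ∀ y : Module.Dual ℝ V, (∀ a ∈ A, u a = -1 → y a = 0) → y = 0
  mem_of_separating : ∀ u : Module.Dual ℝ V, (∀ a ∈ A, -1 ≤ u a) →
    (∀ y : Module.Dual ℝ V, (∀ a ∈ A, u a = -1 → y a = 0) → y = 0) → u ∈ B
  eq_zero : ∀ x : V, (∀ u ∈ B, 0 ≤ u x) → x = 0

namespace IsReflexivePair

variable {V : Type*} [AddCommGroup V] [Module ℝ V] {A : Finset V}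
  {B : Finset (Module.Dual ℝ V)}

/-- A form that vanishes on the active vectors is zero, so these vectors span; being at most `d` in
number, they form a basis. -/
theorem exists_basis (h : IsReflexivePair A B) {u : Module.Dual ℝ V} (hu : u ∈ B)
    (hc : (A.filter fun a => u a = -1).card ≤ Module.finrank ℝ V) :
    ∃ b : Module.Basis (A.filter fun a => u a = -1) ℝ V, ∀ i, b i = i := by
  have htop : ⊤ ≤ Submodule.span ℝ
      (Set.range fun i : (A.filter fun a => u a = -1) => (i : V)) := by
    rw [top_le_iff]
    by_contra hne
    obtain ⟨y, hy, hy0⟩ := Submodule.exists_le_ker_of_lt_top _ (lt_top_iff_ne_top.2 hne)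
    refine hy (h.separating u hu y fun a ha hua => ?_)
    exact hy0 (Submodule.subset_span ⟨⟨a, by simp [ha, hua]⟩, rfl⟩)
  have hle : Module.finrank ℝ V ≤ Fintype.card (A.filter fun a => u a = -1) := by
    have := finrank_range_le_card (R := ℝ) fun i : (A.filter fun a => u a = -1) => (i : V)
    rwa [Set.finrank, top_le_iff.1 htop, finrank_top] at this
  have hli := linearIndependent_of_top_le_span_of_card_eq_finrank htop
    (le_antisymm (by simpa using hc) hle)
  exact ⟨Module.Basis.mk hli htop, fun i => by simp⟩

/-- Moving `u` along a dual basis vector as far as possible gives the adjacent vertex. -/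
theorem exists_adjacent (h : IsReflexivePair A B) {u : Module.Dual ℝ V} (hu : u ∈ B)
    (b : Module.Basis (A.filter fun a => u a = -1) ℝ V) (hb : ∀ i, b i = i)
    (i : (A.filter fun a => u a = -1)) (hi : ∃ a ∈ A, b.coord i a < 0) :
    ∃ u' ∈ B, ∃ t : ℝ, 0 < t ∧ u' = u + t • b.coord i := by
  classical
  -- Ratio test: among the constraints that decrease along `b.coord i`, `a` is the first to become
  -- active.
  obtain ⟨a, ha, hmin⟩ := (A.filter fun a => b.coord i a < 0).exists_min_image
    (fun a => (u a + 1) / (-b.coord i a)) (by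
      obtain ⟨a, ha, h'⟩ := hi
      exact ⟨a, by simp only [Finset.mem_filter]; exact ⟨ha, h'⟩⟩)
  simp only [Finset.mem_filter] at ha hmin
  obtain ⟨haA, hneg⟩ := ha
  -- Active vectors belong to the basis, so their `i`-th coordinate is 0 or 1. Hence `a` is not
  -- active and the step `t` is positive.
  have hca : ∀ j (_ : j ∈ A) (_ : u j = -1), 0 ≤ b.coord i j := by
    intro j hj huj
    have := hb ⟨j, by simp [hj, huj]⟩
    simp only at this
    rw [← this, Module.Basis.coord_apply, b.repr_self, Finsupp.single_apply]
    split_ifs <;> simp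
  have hua : -1 < u a := lt_of_le_of_ne (h.ge u hu a haA) fun he =>
    absurd (hca a haA he.symm) (not_le.2 hneg)
  set t := (u a + 1) / (-b.coord i a) with ht
  have ht0 : 0 < t := div_pos (by linarith) (by linarith)
  have hta : t * b.coord i a = -(u a + 1) := by
    rw [ht, div_mul_eq_mul_div, div_eq_iff (by linarith)]
    ring
  refine ⟨u + t • b.coord i, h.mem_of_separating _ ?_ ?_, t, ht0, rfl⟩
  · intro x hx
    rw [LinearMap.add_apply, LinearMap.smul_apply, smul_eq_mul]
    by_cases hx' : b.coord i x < 0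
    · have := hmin x ⟨hx, hx'⟩
      rw [le_div_iff₀ (by linarith)] at this
      linarith
    · have := h.ge u hu x hx
      have := mul_nonneg ht0.le (not_lt.1 hx')
      linarith
  · intro y hy
    -- The constraints `b j` with `j ≠ i` stay active, so `y` is a multiple of `b.coord i`; the new
    -- constraint `a` makes the multiple zero.
    have hyj : ∀ j, j ≠ i → y (b j) = 0 := by
      intro j hj
      have hj' := j.2
      simp only [Finset.mem_filter] at hj'
      rw [hb]
      refine hy _ hj'.1 ?_
      rw [LinearMap.add_apply, LinearMap.smul_apply, ← hb j, Module.Basis.coord_apply,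
        b.repr_self, Finsupp.single_eq_of_ne hj.symm, hb, hj'.2]
      simp
    have hyc : y = y (b i) • b.coord i := by
      refine b.ext fun j => ?_
      rw [LinearMap.smul_apply, Module.Basis.coord_apply, b.repr_self]
      by_cases hj : j = i
      · subst hj; simp
      · rw [hyj j hj, Finsupp.single_eq_of_ne (Ne.symm hj)]; simp
    have hya : y a = 0 := hy a haA (by
      rw [LinearMap.add_apply, LinearMap.smul_apply, smul_eq_mul, hta]; ring)
    rw [hyc, LinearMap.smul_apply, smul_eq_mul] at hya
    rcases mul_eq_zero.1 hya with h0 | h0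
    · rw [hyc, h0, zero_smul]
    · exact absurd h0 hneg.ne

/-- Integrality enters here: the value at a point of height zero becomes negative, and `-1` is the
only integer in `[-1, 0)`. -/
theorem eq_neg_one_of_adjacent (h : IsReflexivePair A B) {u u' : Module.Dual ℝ V}
    (b : Module.Basis (A.filter fun a => u a = -1) ℝ V) (i : (A.filter fun a => u a = -1))
    (hu' : u' ∈ B) {t : ℝ} (ht : 0 < t) (he : u' = u + t • b.coord i) {x : V} (hx : x ∈ A)
    (hx0 : u x = 0) (hneg : b.coord i x < 0) : u' x = -1 := by
  obtain ⟨n, hn⟩ := h.int u' hu' x hx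
  have h1 := h.ge u' hu' x hx
  have h2 : u' x < 0 := by
    rw [he, LinearMap.add_apply, LinearMap.smul_apply, smul_eq_mul, hx0, zero_add]
    exact mul_neg_of_pos_of_neg ht hneg
  rw [hn] at h1 h2 ⊢
  have h3 : n < 0 := by exact_mod_cast h2
  have h4 : -1 ≤ n := by exact_mod_cast h1
  have : n = -1 := by omega
  simp [this]

/-- If every vertex of the dual lies on at most `d` facets, every height zero element of `A`
lies on an adjacent facet, so that there are at most `d` of them. -/
theorem card_height_zero_le (h : IsReflexivePair A B)
    (hc : ∀ u ∈ B, (A.filter fun a => u a = -1).card ≤ Module.finrank ℝ V)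
    {u : Module.Dual ℝ V} (hu : u ∈ B) :
    (A.filter fun a => u a = 0).card ≤ Module.finrank ℝ V := by
  classical
  obtain ⟨b, hb⟩ := h.exists_basis hu (hc u hu)
  have hub : ∀ i, u (b i) = -1 := fun i => by
    rw [hb]; exact (Finset.mem_filter.1 i.2).2
  have hcard : Fintype.card (A.filter fun a => u a = -1) = Module.finrank ℝ V :=
    (Module.finrank_eq_card_basis b).symm
  -- Since `u` is `-1` on the basis, the coordinates of `x` sum to zero; they are not all zero, so
  -- one is negative.
  have hex : ∀ x ∈ A.filter (fun a => u a = 0), ∃ i, b.coord i x < 0 := by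
    intro x hx
    rw [Finset.mem_filter] at hx
    by_contra! hnn
    have hsum : u x = -∑ i, b.coord i x := by
      conv_lhs => rw [← b.sum_repr x]
      simp [hub]
    have h0 : ∑ i, b.coord i x = 0 := by linarith [hx.2]
    have h1 := (Finset.sum_eq_zero_iff_of_nonneg fun i _ => hnn i).1 h0
    apply h.zero_notMem
    have : x = 0 := by
      rw [← b.sum_repr x]
      exact Finset.sum_eq_zero fun i hi => by
        have := h1 i hi
        rw [Module.Basis.coord_apply] at this
        rw [this, zero_smul]
    exact this ▸ hx.1
  rcases (A.filter fun a => u a = 0).eq_empty_or_nonempty with he | ⟨x₀, hx₀⟩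
  · simp [he]
  have : Nonempty (A.filter fun a => u a = -1) := ⟨(hex x₀ hx₀).choose⟩
  choose! f hf using hex
  rw [← hcard]
  refine (Finset.card_le_card_of_injOn f (fun _ _ => Finset.mem_univ _) ?_).trans_eq
    Finset.card_univ
  intro x hx x' hx' hxx
  have hfx := hf x hx
  have hfx' := hf x' hx'
  have hxx : f x = f x' := hxx
  rw [← hxx] at hfx'
  have hxm := Finset.mem_filter.1 hx
  have hxm' := Finset.mem_filter.1 hx'
  set i := f x
  obtain ⟨u', hu', t, ht, he⟩ := h.exists_adjacent hu b hb i ⟨x, hxm.1, hfx⟩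
  have hx1 := h.eq_neg_one_of_adjacent b i hu' ht he hxm.1 hxm.2 hfx
  have hx1' := h.eq_neg_one_of_adjacent b i hu' ht he hxm'.1 hxm'.2 hfx'
  by_contra hne
  -- Two points `x ≠ x'` with the same `i` would give the adjacent facet `(d - 1) + 2` vertices.
  have hsub : insert x (insert x' ((A.filter fun a => u a = -1).erase i)) ⊆
      A.filter fun a => u' a = -1 := by
    intro j hj
    simp only [Finset.mem_insert, Finset.mem_erase] at hj
    rcases hj with rfl | rfl | ⟨hji, hj⟩
    · exact Finset.mem_filter.2 ⟨hxm.1, hx1⟩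
    · exact Finset.mem_filter.2 ⟨hxm'.1, hx1'⟩
    · have hj' := Finset.mem_filter.1 hj
      refine Finset.mem_filter.2 ⟨hj'.1, ?_⟩
      have hbj : b ⟨j, hj⟩ = j := hb _
      have hc0 : b.coord i j = 0 := by
        rw [← hbj, Module.Basis.coord_apply, b.repr_self, Finsupp.single_eq_of_ne]
        intro h'
        exact hji (by rw [h'])
      rw [he, LinearMap.add_apply, LinearMap.smul_apply, hc0, hj'.2]
      simp
  have h1 := (Finset.card_le_card hsub).trans (hc u' hu')
  rw [Finset.card_insert_of_notMem, Finset.card_insert_of_notMem,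
    Finset.card_erase_of_mem i.2] at h1
  · rw [Fintype.card_coe] at hcard
    have : 0 < (A.filter fun a => u a = -1).card := Finset.card_pos.2 ⟨_, i.2⟩
    omega
  · intro hm
    have := (Finset.mem_filter.1 (Finset.mem_of_mem_erase hm)).2
    rw [hxm'.2] at this
    norm_num at this
  · intro hm
    rcases Finset.mem_insert.1 hm with hm | hm
    · exact hne hm
    · have := (Finset.mem_filter.1 (Finset.mem_of_mem_erase hm)).2
      rw [hxm.2] at this
      norm_num at this

/-- A simplicial reflexive `d`-polytope has at most `3d` vertices. -/
theorem card_le_three_mul (h : IsReflexivePair A B)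
    (hc : ∀ u ∈ B, (A.filter fun a => u a = -1).card ≤ Module.finrank ℝ V) :
    A.card ≤ 3 * Module.finrank ℝ V := by
  classical
  by_contra! hlt
  have hpos : ∀ u ∈ B, 0 < u (∑ a ∈ A, a) := by
    intro u hu
    have h1 := hc u hu
    have h2 := h.card_height_zero_le hc hu
    -- An integer `n ≥ -1` satisfies `n ≥ 1 - 2[n = -1] - [n = 0]`.
    have h3 : ∑ a ∈ A, (1 - 2 * (if u a = -1 then 1 else 0) - (if u a = 0 then 1 else 0) : ℝ)
        ≤ ∑ a ∈ A, u a := by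
      refine Finset.sum_le_sum fun a ha => ?_
      obtain ⟨n, hn⟩ := h.int u hu a ha
      have h4 := h.ge u hu a ha
      rw [hn] at h4 ⊢
      have h5 : -1 ≤ n := by exact_mod_cast h4
      rcases eq_or_lt_of_le h5 with h6 | h6
      · subst h6; norm_num
      · rcases eq_or_lt_of_le (Int.add_one_le_of_lt h6) with h7 | h7
        · have : n = 0 := by omega
          subst this; norm_num
        · have h8 : (1 : ℝ) ≤ n := by exact_mod_cast (by omega : 1 ≤ n)
          rw [if_neg (by linarith), if_neg (by linarith)]
          linarith
    rw [Finset.sum_sub_distrib, Finset.sum_sub_distrib, ← Finset.mul_sum, Finset.sum_boole,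
      Finset.sum_boole, Finset.sum_const, nsmul_eq_mul, mul_one] at h3
    rw [map_sum]
    have h1' : ((A.filter fun a => u a = -1).card : ℝ) ≤ Module.finrank ℝ V := by
      exact_mod_cast h1
    have h2' : ((A.filter fun a => u a = 0).card : ℝ) ≤ Module.finrank ℝ V := by
      exact_mod_cast h2
    have h3' : (3 * Module.finrank ℝ V : ℝ) < A.card := by exact_mod_cast hlt
    linarith
  have hs := h.eq_zero _ fun u hu => (hpos u hu).le
  have hB : B = ∅ := by
    rw [Finset.eq_empty_iff_forall_notMem]
    intro u hu
    have := hpos u hu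
    rw [hs, map_zero] at this
    exact lt_irrefl _ this
  have hA : A.Nonempty := Finset.card_pos.1 (by omega)
  obtain ⟨a, ha⟩ := hA
  exact h.zero_notMem (h.eq_zero a (by simp [hB]) ▸ ha)

end IsReflexivePair

/-! ### Intersections of half-spaces, extreme points and polarity -/

open Filter Topology in
/-- Moving a little in a direction along which the active constraints are constant stays inside. -/
theorem exists_pos_forall_mem_halfspaces {W : Type*} [AddCommGroup W] [Module ℝ W]
    (T : Finset (Module.Dual ℝ W)) {x : W} (hx : ∀ u ∈ T, -1 ≤ u x) (v : W)
    (hv : ∀ u ∈ T, u x = -1 → u v = 0) :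
    ∃ ε : ℝ, 0 < ε ∧ (∀ u ∈ T, -1 ≤ u (x + ε • v)) ∧ ∀ u ∈ T, -1 ≤ u (x - ε • v) := by
  have h : ∀ᶠ ε : ℝ in 𝓝[>] 0, ∀ u ∈ T, ε * |u v| ≤ u x + 1 := by
    rw [Finset.eventually_all]
    intro u hu
    rcases eq_or_lt_of_le (hx u hu) with h1 | h1
    · simp [hv u hu h1.symm, ← h1]
    · have : Tendsto (fun ε : ℝ => ε * |u v|) (𝓝[>] 0) (𝓝 (0 * |u v|)) :=
        (Continuous.tendsto (by fun_prop) 0).mono_left nhdsWithin_le_nhds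
      rw [zero_mul] at this
      exact (this.eventually (gt_mem_nhds (show 0 < u x + 1 by linarith))).mono
        fun _ h => le_of_lt h
  obtain ⟨ε, hε, hε0⟩ := (h.and self_mem_nhdsWithin).exists
  have key : ∀ u ∈ T, |ε * u v| ≤ u x + 1 := fun u hu => by
    rw [abs_mul, abs_of_pos hε0]; exact hε u hu
  refine ⟨ε, hε0, fun u hu => ?_, fun u hu => ?_⟩
  · have := (abs_le.1 (key u hu)).1
    rw [map_add, map_smul, smul_eq_mul]; linarith
  · have := (abs_le.1 (key u hu)).2
    rw [map_sub, map_smul, smul_eq_mul]; linarith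

/-- A point of an intersection of halfspaces is extreme iff its active constraints separate. -/
theorem mem_extremePoints_halfspaces_iff {W : Type*} [AddCommGroup W] [Module ℝ W]
    (T : Finset (Module.Dual ℝ W)) {x : W} :
    x ∈ {x | ∀ u ∈ T, -1 ≤ u x}.extremePoints ℝ ↔
      (∀ u ∈ T, -1 ≤ u x) ∧ ∀ v, (∀ u ∈ T, u x = -1 → u v = 0) → v = 0 := by
  rw [mem_extremePoints_iff_left]
  refine and_congr_right fun hx => ⟨fun h v hv => ?_, fun h y hy z hz hxs => ?_⟩
  · obtain ⟨ε, hε, h1, h2⟩ := exists_pos_forall_mem_halfspaces T hx v hv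
    have := h _ h1 _ h2 ⟨1 / 2, 1 / 2, by norm_num, by norm_num, by norm_num, by module⟩
    rw [add_eq_left, smul_eq_zero] at this
    exact this.resolve_left hε.ne'
  · obtain ⟨a, b, ha, hb, hab, rfl⟩ := hxs
    refine sub_eq_zero.1 (h _ fun u hu hua => ?_)
    -- A constraint that is tight at a proper convex combination is tight at both ends.
    have hy := hy u hu
    have hz := hz u hu
    rw [map_add, map_smul, map_smul, smul_eq_mul, smul_eq_mul] at hua
    rw [map_sub, map_add, map_smul, map_smul, smul_eq_mul, smul_eq_mul, hua, sub_eq_zero]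
    nlinarith [mul_nonneg ha.le (by linarith : 0 ≤ u y + 1), mul_nonneg hb.le
      (by linarith : 0 ≤ u z + 1)]

theorem convexHull_extremePoints_convexHull {W : Type*} [AddCommGroup W] [Module ℝ W]
    [FiniteDimensional ℝ W] {S : Set W} (hS : S.Finite) :
    convexHull ℝ ((convexHull ℝ S).extremePoints ℝ) = convexHull ℝ S := by
  let e := (Module.finBasis ℝ W).equivFun
  have hfin := (hS.image e)
  have key : convexHull ℝ ((convexHull ℝ (e '' S)).extremePoints ℝ) = convexHull ℝ (e '' S) := by
    have h := closure_convexHull_extremePoints (hfin.isCompact_convexHull ℝ) (convex_convexHull ℝ _)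
    rwa [IsClosed.closure_eq] at h
    exact (hfin.subset extremePoints_convexHull_subset).isClosed_convexHull ℝ
  have himg : ∀ T : Set W, e '' convexHull ℝ T = convexHull ℝ (e '' T) := fun T =>
    e.toLinearMap.image_convexHull T
  rw [← himg, ← image_extremePoints e, ← himg] at key
  exact e.injective.image_injective key

theorem IsPolytope.exists_finset {W : Type*} [AddCommGroup W] [Module ℝ W]
    [FiniteDimensional ℝ W] {P : Set W} (hP : IsPolytope P) :
    ∃ A : Finset W, (A : Set W) = P.extremePoints ℝ ∧ P = convexHull ℝ (A : Set W) := by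
  obtain ⟨S, hS, -, rfl⟩ := hP
  have hf : ((convexHull ℝ S).extremePoints ℝ).Finite := hS.subset extremePoints_convexHull_subset
  refine ⟨hf.toFinset, by simp, ?_⟩
  rw [hf.coe_toFinset, convexHull_extremePoints_convexHull hS]

theorem le_of_mem_convexHull {W : Type*} [AddCommGroup W] [Module ℝ W] {S : Set W}
    (u : Module.Dual ℝ W) {c : ℝ} (h : ∀ x ∈ S, c ≤ u x) {x : W} (hx : x ∈ convexHull ℝ S) :
    c ≤ u x :=
  convexHull_min (s := S) (t := {x | c ≤ u x}) h (convex_halfSpace_ge u.isLinear c) hx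

theorem dualPolytope_convexHull {W : Type*} [AddCommGroup W] [Module ℝ W] (S : Set W) :
    dualPolytope (convexHull ℝ S) = {y | ∀ a ∈ S, -1 ≤ y a} :=
  Set.ext fun _ => ⟨fun h a ha => h a (subset_convexHull ℝ S ha), fun h _ hx =>
    le_of_mem_convexHull _ h hx⟩

/-- The bipolar theorem for polytopes. -/
theorem eq_halfspaces_of_dualPolytope_subset {V : Type*} [NormedAddCommGroup V]
    [NormedSpace ℝ V] {S : Set V} (hS : S.Finite) (h0 : 0 ∈ convexHull ℝ S)
    {B : Set (Module.Dual ℝ V)} (hB : B ⊆ dualPolytope (convexHull ℝ S))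
    (hsub : dualPolytope (convexHull ℝ S) ⊆ convexHull ℝ B) :
    convexHull ℝ S = {x | ∀ u ∈ B, -1 ≤ u x} := by
  refine Set.Subset.antisymm (fun x hx u hu => hB hu x hx) fun x hx => ?_
  by_contra hxS
  obtain ⟨f, c, hf, hc⟩ := geometric_hahn_banach_closed_point (convex_convexHull ℝ S)
    (hS.isClosed_convexHull ℝ) hxS
  have hc0 : 0 < c := by simpa using hf 0 h0
  -- Scaled so that its bound on the hull is `-1`, the separating form lies in the dual.
  have hy : (-c⁻¹) • (f : Module.Dual ℝ V) ∈ convexHull ℝ B := hsub fun a ha => by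
    have := hf a ha
    rw [LinearMap.smul_apply, smul_eq_mul, neg_mul, neg_le_neg_iff, inv_mul_le_iff₀ hc0, mul_one]
    exact this.le
  have := le_of_mem_convexHull (Module.Dual.eval ℝ V x) hx hy
  rw [Module.Dual.eval_apply, LinearMap.smul_apply, smul_eq_mul, neg_mul, neg_le_neg_iff,
    inv_mul_le_iff₀ hc0, mul_one] at this
  exact absurd hc (not_lt.2 this)

/-- Every vector can be scaled into `P`, so `y` is non-negative on both `v` and `-v`. -/
theorem dual_eq_zero_of_nonneg_of_mem_interior {V : Type*} [NormedAddCommGroup V] [NormedSpace ℝ V]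
    {P : Set V} (h0 : (0 : V) ∈ interior P) {y : Module.Dual ℝ V} (hy : ∀ x ∈ P, 0 ≤ y x) :
    y = 0 := by
  refine LinearMap.ext fun v => ?_
  have h : ∀ w : V, 0 ≤ y w := by
    intro w
    have ht : Filter.Tendsto (fun ε : ℝ => ε • w) (nhdsWithin 0 (Set.Ioi 0)) (nhds ((0 : ℝ) • w)) :=
      (Continuous.tendsto (by fun_prop) 0).mono_left nhdsWithin_le_nhds
    rw [zero_smul] at ht
    obtain ⟨ε, hε, hε0⟩ := ((ht.eventually (mem_interior_iff_mem_nhds.1 h0)).and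
      self_mem_nhdsWithin).exists
    have := hy _ hε
    rw [map_smul, smul_eq_mul] at this
    exact nonneg_of_mul_nonneg_right this hε0
  have h1 := h v
  have h2 := h (-v)
  rw [map_neg] at h2
  rw [LinearMap.zero_apply]
  linarith

theorem eq_zero_of_forall_smul_mem {V : Type*} [NormedAddCommGroup V] [NormedSpace ℝ V]
    {P : Set V} (hP : Bornology.IsBounded P) {x : V} (hx : ∀ n : ℕ, (n : ℝ) • x ∈ P) : x = 0 := by
  obtain ⟨C, hC⟩ := hP.exists_norm_le
  by_contra hne
  obtain ⟨n, hn⟩ := exists_nat_gt (C / ‖x‖)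
  have := hC _ (hx n)
  rw [norm_smul, Real.norm_natCast] at this
  rw [div_lt_iff₀ (norm_pos_iff.2 hne)] at hn
  linarith

/-! ### The two vertex sets of a reflexive polytope -/

/-- Vertices and facets (given by the vertices of the dual) of a polytope. -/
structure IsVertexFacetPair {V : Type*} [AddCommGroup V] [Module ℝ V] (P : Set V)
    (A : Finset V) (B : Finset (Module.Dual ℝ V)) : Prop where
  vertices : (A : Set V) = P.extremePoints ℝ
  eq_convexHull : P = convexHull ℝ (A : Set V)
  eq_halfspaces : P = {x | ∀ u ∈ B, -1 ≤ u x}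
  zero_mem : (0 : V) ∈ P
  separating : ∀ u ∈ B, ∀ y : Module.Dual ℝ V, (∀ a ∈ A, u a = -1 → y a = 0) → y = 0
  zero_notMem : (0 : Module.Dual ℝ V) ∉ B
  card_le_of_simplicial : (∀ u ∈ B, (A.filter fun a => u a = -1).card ≤ Module.finrank ℝ V) →
    A.card ≤ 3 * Module.finrank ℝ V
  card_le_of_simple : (∀ a ∈ A, (B.filter fun u => u a = -1).card ≤ Module.finrank ℝ V) →
    B.card ≤ 3 * Module.finrank ℝ V

/-- The bound is applied twice: to `(A, B)` for simplicial `P`, and to `(B, A)` with `A` embedded in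
the double dual for simple `P`. -/
theorem IsReflexivePolytope.exists_isVertexFacetPair {V : Type*} [NormedAddCommGroup V]
    [NormedSpace ℝ V] [FiniteDimensional ℝ V] [Nontrivial V] {L : Submodule ℤ V} {P : Set V}
    (h : IsReflexivePolytope L P) : ∃ A B, IsVertexFacetPair P A B := by
  classical
  obtain ⟨A, hA, hPA⟩ := h.isFanoPolytope.isLatticePolytope.1.exists_finset
  obtain ⟨B, hB, hPB⟩ := h.dual_isLatticePolytope.1.exists_finset
  have h0 := h.isFanoPolytope.zero_mem_interior
  have h0P := interior_subset h0
  have hAe : ∀ a ∈ A, a ∈ P.extremePoints ℝ := fun a ha => hA ▸ Finset.mem_coe.2 ha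
  have hBe : ∀ u ∈ B, u ∈ (dualPolytope P).extremePoints ℝ := fun u hu =>
    hB ▸ Finset.mem_coe.2 hu
  have hAL : ∀ a ∈ A, a ∈ L := fun a ha => h.isFanoPolytope.isLatticePolytope.2 (hAe a ha)
  have hBL : ∀ u ∈ B, u ∈ dualLattice L := fun a ha => h.dual_isLatticePolytope.2 (hBe a ha)
  have hAP : ∀ a ∈ A, a ∈ P := fun a ha => extremePoints_subset (hAe a ha)
  have hBP : ∀ u ∈ B, u ∈ dualPolytope P := fun a ha => extremePoints_subset (hBe a ha)
  have hPhalf : P = {x | ∀ u ∈ B, -1 ≤ u x} := by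
    have := eq_halfspaces_of_dualPolytope_subset (B := (B : Set (Module.Dual ℝ V)))
      A.finite_toSet (hPA ▸ h0P) (by rw [← hPA]; exact hBP) (by rw [← hPA, ← hPB])
    rw [← hPA] at this
    simpa using this
  have hDhalf : dualPolytope P = {y | ∀ u ∈ A.image (Module.Dual.eval ℝ V), -1 ≤ u y} := by
    conv_lhs => rw [hPA, dualPolytope_convexHull]
    simp
  have hAext : ∀ x, x ∈ A ↔ (∀ u ∈ B, -1 ≤ u x) ∧ ∀ v, (∀ u ∈ B, u x = -1 → u v = 0) → v = 0 := by
    intro x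
    rw [← mem_extremePoints_halfspaces_iff, ← hPhalf, ← hA, Finset.mem_coe]
  have hBext : ∀ u, u ∈ B ↔ (∀ a ∈ A, -1 ≤ u a) ∧
      ∀ y : Module.Dual ℝ V, (∀ a ∈ A, u a = -1 → y a = 0) → y = 0 := by
    intro u
    have := mem_extremePoints_halfspaces_iff (A.image (Module.Dual.eval ℝ V)) (x := u)
    rw [← hDhalf, ← hB, Finset.mem_coe] at this
    simpa using this
  have hB0 : (0 : Module.Dual ℝ V) ∉ B := by
    intro h0
    obtain ⟨y, hy⟩ := exists_ne (0 : Module.Dual ℝ V)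
    exact hy (((hBext 0).1 h0).2 y (by simp))
  have hint : ∀ u ∈ B, ∀ a ∈ A, ∃ n : ℤ, u a = n := fun u hu a ha => hBL u hu a (hAL a ha)
  have hge : ∀ u ∈ B, ∀ a ∈ A, -1 ≤ u a := fun u hu a ha => hBP u hu a (hAP a ha)
  have pair : IsReflexivePair A B :=
    { int := hint
      ge := hge
      zero_notMem := fun h' => (h.isFanoPolytope.primitive 0 (hAe 0 h')).2.1 rfl
      separating := fun u hu => ((hBext u).1 hu).2
      mem_of_separating := fun u h1 h2 => (hBext u).2 ⟨h1, h2⟩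
      eq_zero := by
        intro x hx
        have hbd : Bornology.IsBounded P := by
          rw [hPA]; exact (A.finite_toSet.isCompact_convexHull ℝ).isBounded
        refine eq_zero_of_forall_smul_mem hbd fun n => ?_
        rw [hPhalf]
        intro u hu
        rw [map_smul, smul_eq_mul]
        have := mul_nonneg (Nat.cast_nonneg (α := ℝ) n) (hx u hu)
        linarith }
  have pair' : IsReflexivePair B (A.image (Module.Dual.eval ℝ V)) :=
    { int := by simpa using fun a ha u hu => hint u hu a ha
      ge := by simpa using fun a ha u hu => hge u hu a ha
      zero_notMem := hB0
      separating := by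
        simp only [Finset.mem_image, forall_exists_index, and_imp, forall_apply_eq_imp_iff₂,
          Module.Dual.eval_apply]
        intro a ha Y hY
        obtain ⟨v, rfl⟩ := (Module.evalEquiv ℝ V).surjective Y
        rw [((hAext a).1 ha).2 v fun u hu hua => by simpa using hY u hu hua, map_zero]
      mem_of_separating := by
        intro X h1 h2
        obtain ⟨x, rfl⟩ := (Module.evalEquiv ℝ V).surjective X
        refine Finset.mem_image.2 ⟨x, (hAext x).2 ⟨by simpa using h1, fun v hv => ?_⟩, rfl⟩
        exact (Module.evalEquiv ℝ V).map_eq_zero_iff.1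
          (h2 (Module.evalEquiv ℝ V v) (by simpa using hv))
      eq_zero := by
        intro y hy
        refine dual_eq_zero_of_nonneg_of_mem_interior h0 fun x hx => ?_
        rw [hPA] at hx
        exact le_of_mem_convexHull y (by simpa using hy) hx }
  refine ⟨A, B, hA, hPA, hPhalf, h0P, pair.separating, hB0, pair.card_le_three_mul, fun hc => ?_⟩
  have := pair'.card_le_three_mul
  rw [Subspace.dual_finrank_eq] at this
  refine this fun X hX => ?_
  obtain ⟨a, ha, rfl⟩ := Finset.mem_image.1 hX
  convert hc a ha using 3
  rfl

/-! ### Atoms of the face lattice -/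

/-- The minimal elements among the non-bottom elements: the atoms. -/
def atomSet (α : Type*) [PartialOrder α] : Set α := {F | Minimal (fun G => ¬IsMin G) F}

/-- Every element that is not the top lies above at most `n` atoms. -/
def IsAtomBounded (α : Type*) [PartialOrder α] (n : ℕ) : Prop :=
  ∀ G : α, ¬IsMax G → {F ∈ atomSet α | F ≤ G}.encard ≤ n

theorem OrderIso.mem_atomSet {α β : Type*} [PartialOrder α] [PartialOrder β] (e : α ≃o β) {F : α}
    (hF : F ∈ atomSet α) : e F ∈ atomSet β := by
  refine ⟨fun h => hF.1 (e.isMin_apply.1 h), fun G hG hle => ?_⟩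
  have := hF.2 (y := e.symm G) (fun h => hG (e.symm.isMin_apply.1 h)) (e.symm_apply_le.2 hle)
  exact e.le_symm_apply.1 this

theorem OrderIso.encard_atomSet_le {α β : Type*} [PartialOrder α] [PartialOrder β] (e : α ≃o β) :
    (atomSet α).encard ≤ (atomSet β).encard :=
  Set.encard_le_encard_of_injOn (f := e) (fun _ hF => e.mem_atomSet hF) e.injective.injOn

theorem IsAtomBounded.of_orderIso {α β : Type*} [PartialOrder α] [PartialOrder β] (e : α ≃o β)
    {n : ℕ} (h : IsAtomBounded β n) : IsAtomBounded α n := fun G hG =>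
  (Set.encard_le_encard_of_injOn (f := e) 
    (t := {F ∈ atomSet β | F ≤ e G}) (fun _ hF => ⟨e.mem_atomSet hF.1, e.monotone hF.2⟩)
    e.injective.injOn).trans (h (e G) fun h' => hG (e.isMax_apply.1 h'))

/-- Atoms of the opposite order are coatoms, so statements about vertices transfer to facets. -/
theorem toDual_mem_atomSet {α : Type*} [PartialOrder α] {F : α} :
    OrderDual.toDual F ∈ atomSet αᵒᵈ ↔ Maximal (fun G => ¬IsMax G) F :=
  ⟨fun h => ⟨fun h' => h.1 h', fun _ hG hle => h.2 (fun h' => hG h') hle⟩,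
    fun h => ⟨fun h' => h.1 h', fun _ hG hle => h.2 (fun h' => hG h') hle⟩⟩

namespace PolytopeFace

variable {V : Type*} [NormedAddCommGroup V] [NormedSpace ℝ V] {P : Set V}

theorem isMin_iff {F : PolytopeFace P} : IsMin F ↔ F.1 = ∅ := by
  refine ⟨fun h => ?_, fun h G _ x hx => ?_⟩
  · have := @h ⟨∅, isExposed_empty⟩ (Set.empty_subset _)
    exact Set.subset_empty_iff.1 this
  · rw [h] at hx; exact hx.elim

theorem isMax_iff {F : PolytopeFace P} : IsMax F ↔ F.1 = P := by
  refine ⟨fun h => ?_, fun h G _ x hx => ?_⟩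
  · have := @h ⟨P, IsExposed.refl P⟩ F.2.subset
    exact Set.Subset.antisymm F.2.subset this
  · rw [h]; exact G.2.subset hx

theorem not_isMin_iff {F : PolytopeFace P} : ¬IsMin F ↔ F.1.Nonempty := by
  rw [isMin_iff, Set.nonempty_iff_ne_empty]

/-- The intersection of two faces is a face; if it is non-empty, it equals each of two atoms that
contain it. -/
theorem eq_of_mem_atomSet {F F' : PolytopeFace P} (hF : F ∈ atomSet (PolytopeFace P))
    (hF' : F' ∈ atomSet (PolytopeFace P)) {x : V} (hx : x ∈ F.1) (hx' : x ∈ F'.1) : F = F' := by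
  have hn : ¬IsMin (⟨F.1 ∩ F'.1, F.2.inter F'.2⟩ : PolytopeFace P) :=
    not_isMin_iff.2 ⟨x, hx, hx'⟩
  have h1 := hF.2 hn (show F.1 ∩ F'.1 ⊆ F.1 from Set.inter_subset_left)
  have h2 := hF'.2 hn (show F.1 ∩ F'.1 ⊆ F'.1 from Set.inter_subset_right)
  exact le_antisymm (h1.trans (show F.1 ∩ F'.1 ⊆ F'.1 from Set.inter_subset_right))
    (h2.trans (show F.1 ∩ F'.1 ⊆ F.1 from Set.inter_subset_left))

theorem mem_atomSet_of_singleton {F : PolytopeFace P} {x : V} (hF : F.1 = {x}) :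
    F ∈ atomSet (PolytopeFace P) := by
  refine ⟨not_isMin_iff.2 (hF ▸ Set.singleton_nonempty x), fun G hG hle => ?_⟩
  have hle : G.1 ⊆ F.1 := hle
  rw [hF] at hle
  have := (Set.subset_singleton_iff_eq.1 hle).resolve_left (not_isMin_iff.1 hG).ne_empty
  exact (hF.trans this.symm).le

theorem exists_extremePoint (hP : IsCompact P) {F : PolytopeFace P} (hF : F.1.Nonempty) :
    ∃ x ∈ P.extremePoints ℝ, x ∈ F.1 := by
  obtain ⟨x, hx⟩ := (F.2.isCompact hP).extremePoints_nonempty hF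
  exact ⟨x, F.2.isExtreme.extremePoints_subset_extremePoints hx, extremePoints_subset hx⟩

/-- The number of atoms below a face is at most the number of vertices in it. -/
theorem encard_atoms_le (hP : IsCompact P) {X : Set V} (hX : P.extremePoints ℝ ⊆ X)
    (G : PolytopeFace P) : {F ∈ atomSet (PolytopeFace P) | F ≤ G}.encard ≤ (X ∩ G.1).encard := by
  have h : ∀ F ∈ {F ∈ atomSet (PolytopeFace P) | F ≤ G}, ∃ x ∈ X ∩ G.1, x ∈ F.1 := by
    intro F hF
    obtain ⟨x, hx, hxF⟩ := exists_extremePoint hP (not_isMin_iff.1 hF.1.1)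
    exact ⟨x, ⟨hX hx, hF.2 hxF⟩, hxF⟩
  choose! f hf hfF using h
  refine Set.encard_le_encard_of_injOn (f := f) hf fun F hF F' hF' he => ?_
  exact eq_of_mem_atomSet hF.1 hF'.1 (hfF F hF) (he ▸ hfF F' hF')

end PolytopeFace

/-! ### Facets as coatoms, vertices as atoms -/

section Exposed

variable {V : Type*} [NormedAddCommGroup V] [NormedSpace ℝ V] [FiniteDimensional ℝ V] {P : Set V}

theorem isExposed_of_le (l : Module.Dual ℝ V) {c : ℝ} (h : ∀ x ∈ P, c ≤ l x) :
    IsExposed ℝ P {x ∈ P | l x = c} := by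
  rintro ⟨x₀, hx₀, hc⟩
  refine ⟨-LinearMap.toContinuousLinearMap l, Set.ext fun x => ?_⟩
  simp only [Set.mem_ofPred_eq, neg_apply,
    LinearMap.coe_toContinuousLinearMap', neg_le_neg_iff]
  refine and_congr_right fun hx => ⟨fun hxc y hy => hxc.trans_le (h y hy), fun hxy => ?_⟩
  exact le_antisymm ((hxy x₀ hx₀).trans_eq hc) (h x hx)

omit [FiniteDimensional ℝ V] in
/-- A proper face of an intersection of halfspaces lies in one of the bounding hyperplanes. -/
theorem exists_subset_of_isExposed {T : Finset (Module.Dual ℝ V)} {C : Set V}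
    (hC : C = {x | ∀ u ∈ T, -1 ≤ u x}) {F : Set V} (hF : IsExposed ℝ C F) (hne : F.Nonempty)
    (hFC : F ≠ C) : ∃ u ∈ T, ∀ x ∈ F, u x = -1 := by
  classical
  by_contra! hT
  have hFm : ∀ x ∈ F, ∀ u ∈ T, -1 ≤ u x := fun x hx => by
    have := hF.subset hx
    rwa [hC] at this
  have hconv : Convex ℝ C := by
    rw [hC]
    simp only [Set.ofPred_forall]
    exact convex_iInter₂ fun u _ => convex_halfSpace_ge u.isLinear _
  -- Averaging points at which single constraints are strict gives a point of `F` at which all are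
  -- strict.
  have key : ∀ S ⊆ T, ∃ q ∈ F, ∀ u ∈ S, -1 < u q := by
    intro S
    induction S using Finset.induction_on with
    | empty => exact fun _ => ⟨hne.some, hne.some_mem, by simp⟩
    | insert w S _ ih =>
      intro hS
      obtain ⟨q, hq, hqS⟩ := ih ((Finset.subset_insert _ _).trans hS)
      have hw : w ∈ T := hS (Finset.mem_insert_self _ _)
      obtain ⟨p, hp, hpw⟩ := hT w hw
      refine ⟨(1 / 2 : ℝ) • q + (1 / 2 : ℝ) • p, (hF.convex hconv) hq hp (by norm_num)
        (by norm_num) (by norm_num), fun u hu => ?_⟩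
      rw [map_add, map_smul, map_smul, smul_eq_mul, smul_eq_mul]
      rcases Finset.mem_insert.1 hu with rfl | hu'
      · have h1 := lt_of_le_of_ne (hFm p hp u hw) hpw.symm
        have h2 := hFm q hq u hw
        linarith
      · have h1 := hFm p hp u (hS hu)
        have h2 := hqS u hu'
        linarith
  obtain ⟨q, hq, hqT⟩ := key T subset_rfl
  obtain ⟨l, hl⟩ := hF hne
  have hqC := hF.subset hq
  have hmax : ∀ y ∈ C, l y ≤ l q := by
    rw [hl] at hq; exact hq.2
  -- From `q` one can move a little in any direction, so a form that is maximal at `q` vanishes and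
  -- its face is all of `C`.
  have hl0 : ∀ v, l v ≤ 0 := by
    intro v
    obtain ⟨ε, hε, h1, -⟩ := exists_pos_forall_mem_halfspaces T (hFm q hq) v
      fun u hu h => absurd h (hqT u hu).ne'
    have := hmax (q + ε • v) (by rw [hC]; exact h1)
    rw [map_add, map_smul, smul_eq_mul] at this
    exact nonpos_of_mul_nonpos_right (by linarith) hε
  have hl0' : ∀ v, l v = 0 := fun v => by
    have h1 := hl0 v
    have h2 := hl0 (-v)
    rw [map_neg] at h2
    linarith
  apply hFC
  rw [hl]
  ext x
  simp [hl0']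

/-- An irredundant description by finitely many halfspaces `{x | -1 ≤ u x}`. -/
structure IsFacetDescription (C : Set V) (T : Finset (Module.Dual ℝ V)) : Prop where
  eq : C = {x | ∀ u ∈ T, -1 ≤ u x}
  nonempty : T.Nonempty
  irredundant : ∀ u ∈ T, ∀ w ∈ T, (∀ x ∈ C, u x = -1 → w x = -1) → u = w

namespace IsFacetDescription

variable {C : Set V} {T : Finset (Module.Dual ℝ V)}

omit [FiniteDimensional ℝ V] in
theorem le (h : IsFacetDescription C T) {u : Module.Dual ℝ V} (hu : u ∈ T) {x : V} (hx : x ∈ C) :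
    -1 ≤ u x := by
  rw [h.eq] at hx
  exact hx u hu

/-- The facet given by a halfspace of the description. -/
def facet (h : IsFacetDescription C T) (u : T) : PolytopeFace C :=
  ⟨{x ∈ C | u.1 x = -1}, isExposed_of_le u.1 fun _ hx => h.le u.2 hx⟩

theorem facet_le_facet_iff (h : IsFacetDescription C T) {u w : T} :
    h.facet u ≤ h.facet w ↔ u = w :=
  ⟨fun hle => Subtype.ext (h.irredundant u u.2 w w.2 fun _ hx hux => (hle ⟨hx, hux⟩).2),
    fun e => e ▸ le_rfl⟩

theorem facet_injective (h : IsFacetDescription C T) : Function.Injective h.facet :=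
  fun _ _ he => h.facet_le_facet_iff.1 he.le

omit [FiniteDimensional ℝ V] in
theorem zero_mem (h : IsFacetDescription C T) : (0 : V) ∈ C := by
  rw [h.eq]
  intro u _
  rw [map_zero]
  norm_num

theorem not_isMax_facet (h : IsFacetDescription C T) (u : T) : ¬IsMax (h.facet u) := by
  rw [PolytopeFace.isMax_iff]
  intro he
  have h0 := h.zero_mem
  rw [← he] at h0
  have := h0.2
  rw [map_zero] at this
  norm_num at this

theorem exists_le_facet (h : IsFacetDescription C T) {G : PolytopeFace C} (hG : ¬IsMax G) :
    ∃ u, G ≤ h.facet u := by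
  rw [PolytopeFace.isMax_iff] at hG
  rcases G.1.eq_empty_or_nonempty with he | hne
  · obtain ⟨u, hu⟩ := h.nonempty
    exact ⟨⟨u, hu⟩, fun x hx => by rw [he] at hx; exact hx.elim⟩
  · obtain ⟨u, hu, hux⟩ := exists_subset_of_isExposed h.eq G.2 hne hG
    exact ⟨⟨u, hu⟩, fun x hx => ⟨G.2.subset hx, hux x hx⟩⟩

/-- Every proper face lies in a facet, and by irredundancy no facet contains another; so the facets
are the coatoms. -/
theorem atomSet_dual (h : IsFacetDescription C T) :
    atomSet (PolytopeFace C)ᵒᵈ = Set.range fun u => OrderDual.toDual (h.facet u) := by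
  ext F
  obtain ⟨F, rfl⟩ := OrderDual.toDual.surjective F
  rw [toDual_mem_atomSet]
  constructor
  · intro hF
    obtain ⟨u, hu⟩ := h.exists_le_facet hF.1
    exact ⟨u, congrArg _ (le_antisymm (hF.2 (h.not_isMax_facet u) hu) hu)⟩
  · rintro ⟨u, hu⟩
    obtain rfl := OrderDual.toDual.injective hu
    refine ⟨h.not_isMax_facet u, fun G hG hle => ?_⟩
    obtain ⟨w, hw⟩ := h.exists_le_facet hG
    rwa [h.facet_le_facet_iff.1 (hle.trans hw)]

theorem encard_atomSet_dual (h : IsFacetDescription C T) :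
    (atomSet (PolytopeFace C)ᵒᵈ).encard = T.card := by
  have hinj : Function.Injective fun u => OrderDual.toDual (h.facet u) :=
    OrderDual.toDual.injective.comp h.facet_injective
  rw [h.atomSet_dual, ← Set.image_univ, hinj.injOn.encard_image]
  simp

theorem encard_atoms_dual (h : IsFacetDescription C T) (G : PolytopeFace C) :
    {F ∈ atomSet (PolytopeFace C)ᵒᵈ | F ≤ OrderDual.toDual G}.encard =
      {u : T | G ≤ h.facet u}.encard := by
  have hinj : Function.Injective fun u => OrderDual.toDual (h.facet u) :=
    OrderDual.toDual.injective.comp h.facet_injective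
  rw [← hinj.injOn.encard_image, h.atomSet_dual]
  congr 1
  ext F
  constructor
  · rintro ⟨⟨u, rfl⟩, hle⟩
    exact ⟨u, hle, rfl⟩
  · rintro ⟨u, hu, rfl⟩
    exact ⟨⟨u, rfl⟩, hu⟩

/-- A non-maximal element of the opposite order is a non-empty face, and every facet above it
contains any chosen point of it. -/
theorem isAtomBounded_dual (h : IsFacetDescription C T) {n : ℕ}
    (hn : ∀ x ∈ C, (T.filter fun u => u x = -1).card ≤ n) :
    IsAtomBounded (PolytopeFace C)ᵒᵈ n := by
  intro G hG
  obtain ⟨G, rfl⟩ := OrderDual.toDual.surjective G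
  rw [h.encard_atoms_dual]
  obtain ⟨x, hx⟩ := PolytopeFace.not_isMin_iff.1 fun h' : IsMin G => hG h'
  refine le_trans ?_ (Nat.cast_le.2 (hn x (G.2.subset hx)))
  rw [← Set.encard_coe_eq_coe_finsetCard]
  refine Set.encard_le_encard_of_injOn (f := Subtype.val) (fun u hu => ?_)
    Subtype.val_injective.injOn
  simp only [Finset.coe_filter]
  exact ⟨u.2, (hu hx).2⟩

theorem card_filter_le (h : IsFacetDescription C T) {n : ℕ}
    (hn : IsAtomBounded (PolytopeFace C)ᵒᵈ n) {x : V} (hx : IsExposed ℝ C {x}) :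
    (T.filter fun u => u x = -1).card ≤ n := by
  classical
  have h1 := hn (OrderDual.toDual ⟨{x}, hx⟩)
    fun h' => PolytopeFace.not_isMin_iff.2 (Set.singleton_nonempty x) fun _ hG => h' hG
  rw [h.encard_atoms_dual] at h1
  rw [← Nat.cast_le (α := ℕ∞), ← Set.encard_coe_eq_coe_finsetCard]
  refine le_trans ?_ h1
  have hxC : x ∈ C := hx.subset rfl
  have himg : ((T.filter fun u => u x = -1 : Finset _) : Set (Module.Dual ℝ V)) ⊆
      Subtype.val '' {u : T | (⟨{x}, hx⟩ : PolytopeFace C) ≤ h.facet u} := by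
    intro u hu
    simp only [Finset.coe_filter] at hu
    refine ⟨⟨u, hu.1⟩, fun y hy => ?_, rfl⟩
    rw [Set.mem_singleton_iff.1 hy]
    exact ⟨hxC, hu.2⟩
  exact (Set.encard_le_encard himg).trans (Set.encard_image_le _ _)

end IsFacetDescription

namespace IsVertexFacetPair

variable [Nontrivial V] {A : Finset V} {B : Finset (Module.Dual ℝ V)}

omit [FiniteDimensional ℝ V] [Nontrivial V] in
theorem isCompact (h : IsVertexFacetPair P A B) : IsCompact P := by
  rw [h.eq_convexHull]
  exact A.finite_toSet.isCompact_convexHull ℝ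

-- If `B` were empty, `P` would be the whole non-trivial space and so unbounded. If `w` is `-1` on
-- the facet of `u`, then `u - w` vanishes on the active vectors of `u`, which separate.
omit [FiniteDimensional ℝ V] in
theorem isFacetDescription (h : IsVertexFacetPair P A B) : IsFacetDescription P B where
  eq := h.eq_halfspaces
  nonempty := by
    by_contra hB
    rw [Finset.not_nonempty_iff_eq_empty] at hB
    obtain ⟨v, hv⟩ := exists_ne (0 : V)
    refine hv (eq_zero_of_forall_smul_mem h.isCompact.isBounded fun n => ?_)
    rw [h.eq_halfspaces, hB]
    intro u hu
    exact absurd hu (Finset.notMem_empty u)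
  irredundant u hu w hw huw := by
    refine sub_eq_zero.1 (h.separating u hu _ fun a ha hua => ?_)
    have haP : a ∈ P := extremePoints_subset (h.vertices ▸ Finset.mem_coe.2 ha)
    rw [LinearMap.sub_apply, hua, huw a haP hua, sub_self]

-- The sum of the forms active at `a` is minimal on `P` at `a`. Equality at `x` forces each of them
-- to be minimal at `x`, and the active forms separate points.
omit [Nontrivial V] in
theorem isExposed_singleton (h : IsVertexFacetPair P A B) {a : V} (ha : a ∈ A) :
    IsExposed ℝ P {a} := by
  have hext : a ∈ P.extremePoints ℝ := h.vertices ▸ Finset.mem_coe.2 ha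
  have haP := extremePoints_subset hext
  rw [h.eq_halfspaces, mem_extremePoints_halfspaces_iff] at hext
  have hle : ∀ x ∈ P, ∀ u ∈ B.filter (fun u => u a = -1), u a ≤ u x := by
    intro x hx u hu
    rw [(Finset.mem_filter.1 hu).2]
    rw [h.eq_halfspaces] at hx
    exact hx u (Finset.mem_filter.1 hu).1
  have := isExposed_of_le (P := P) (∑ u ∈ B.filter (fun u => u a = -1), u)
    (c := ∑ u ∈ B.filter (fun u => u a = -1), u a) (fun x hx => by
      rw [LinearMap.sum_apply]
      exact Finset.sum_le_sum (hle x hx))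
  convert this
  refine Set.Subset.antisymm ?_ fun x hx => ?_
  · rintro _ rfl
    exact ⟨haP, LinearMap.sum_apply _ _ _⟩
  · obtain ⟨hxP, hx⟩ := hx
    rw [LinearMap.sum_apply] at hx
    have heq := (Finset.sum_eq_sum_iff_of_le (hle x hxP)).1 hx.symm
    refine sub_eq_zero.1 (hext.2 _ fun u hu hua => ?_)
    rw [map_sub, ← heq u (Finset.mem_filter.2 ⟨hu, hua⟩), sub_self]

/-- Vertices on a facet are distinct atoms below it, so the order-theoretic hypothesis says that `P`
is simplicial. -/
theorem encard_atomSet_le (h : IsVertexFacetPair P A B)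
    (hP : IsAtomBounded (PolytopeFace P) (Module.finrank ℝ V)) :
    (atomSet (PolytopeFace P)).encard ≤ (3 * Module.finrank ℝ V : ℕ) := by
  have hA := h.card_le_of_simplicial fun u hu => by
    have h1 := hP (h.isFacetDescription.facet ⟨u, hu⟩) (h.isFacetDescription.not_isMax_facet _)
    rw [← Nat.cast_le (α := ℕ∞), ← Set.encard_coe_eq_coe_finsetCard]
    refine le_trans ?_ h1
    have hex : ∀ a ∈ ((A.filter fun a => u a = -1 : Finset V) : Set V),
        ∃ F : PolytopeFace P, F.1 = {a} := fun a ha =>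
      ⟨⟨{a}, h.isExposed_singleton (Finset.mem_filter.1 (Finset.mem_coe.1 ha)).1⟩, rfl⟩
    have : Nonempty (PolytopeFace P) := ⟨⟨P, IsExposed.refl P⟩⟩
    choose! f hf using hex
    refine Set.encard_le_encard_of_injOn (f := f) (fun a ha => ?_) fun a ha b hb hab => ?_
    · refine ⟨PolytopeFace.mem_atomSet_of_singleton (hf a ha), ?_⟩
      intro x hx
      rw [hf a ha, Set.mem_singleton_iff] at hx
      subst hx
      have ha' := Finset.mem_filter.1 (Finset.mem_coe.1 ha)
      exact ⟨extremePoints_subset (h.vertices ▸ Finset.mem_coe.2 ha'.1), ha'.2⟩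
    · exact Set.singleton_injective ((hf a ha).symm.trans ((congrArg Subtype.val hab).trans (hf b hb)))
  refine le_trans ?_ (Nat.cast_le.2 hA)
  have h2 := PolytopeFace.encard_atoms_le h.isCompact h.vertices.ge ⟨P, IsExposed.refl P⟩
  rw [← Set.encard_coe_eq_coe_finsetCard]
  refine le_trans (Set.encard_le_encard fun F hF => ?_)
    (h2.trans (Set.encard_le_encard Set.inter_subset_left))
  exact ⟨hF, F.2.subset⟩

theorem encard_atomSet_dual_le (h : IsVertexFacetPair P A B)
    (hP : IsAtomBounded (PolytopeFace P)ᵒᵈ (Module.finrank ℝ V)) :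
    (atomSet (PolytopeFace P)ᵒᵈ).encard ≤ (3 * Module.finrank ℝ V : ℕ) := by
  rw [h.isFacetDescription.encard_atomSet_dual, Nat.cast_le]
  exact h.card_le_of_simple fun a ha =>
    h.isFacetDescription.card_filter_le hP (h.isExposed_singleton ha)

end IsVertexFacetPair

end Exposed

/-! ### Simplicial polytopes from relations between vertices -/

open Matrix

/-- A finite centrally symmetric set `X` on a sphere such that any two elements of `X` have inner
product `α`, or a multiple `c` of their sum is a sum of fewer than `2 * c` elements of `X`. -/
structure IsSimplicialSystem {n : ℕ} (X : Finset (Fin n → ℝ)) (α β : ℝ) : Prop where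
  nonneg : 0 ≤ α
  lt : α < β
  norm : ∀ x ∈ X, x ⬝ᵥ x = β
  neg : ∀ x ∈ X, -x ∈ X
  pair : ∀ x ∈ X, ∀ y ∈ X, x = y ∨ x ⬝ᵥ y = α ∨ ∃ N : List (Fin n → ℝ), ∃ c : ℝ,
    (∀ z ∈ N, z ∈ X) ∧ N.sum = c • (x + y) ∧ (N.length : ℝ) < 2 * c

/-- The Gram matrix is `(β - α) I + α J`, with `J` the all-ones matrix; it is positive definite
since `β > α ≥ 0`. -/
theorem linearIndependent_of_dotProduct_eq {n : ℕ} {K : Finset (Fin n → ℝ)} {α β : ℝ}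
    (hα : 0 ≤ α) (hαβ : α < β) (hn : ∀ x ∈ K, x ⬝ᵥ x = β)
    (hp : ∀ x ∈ K, ∀ y ∈ K, x ≠ y → x ⬝ᵥ y = α) :
    LinearIndependent ℝ fun x : K => (x : Fin n → ℝ) := by
  classical
  rw [Fintype.linearIndependent_iff]
  intro g hg
  have key : ∀ j, (β - α) * g j + α * ∑ i, g i = 0 := by
    intro j
    have h1 := congrArg (fun v => v ⬝ᵥ (j : Fin n → ℝ)) hg
    simp only [sum_dotProduct, smul_dotProduct, zero_dotProduct, smul_eq_mul] at h1
    rw [← h1, Finset.mul_sum, ← Finset.add_sum_erase _ _ (Finset.mem_univ j),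
      ← Finset.add_sum_erase _ (fun i => g i * _) (Finset.mem_univ j), hn j j.2, ← add_assoc]
    congr 1
    · ring
    · refine Finset.sum_congr rfl fun i hi => ?_
      rw [hp i i.2 j j.2 fun h => (Finset.mem_erase.1 hi).1 (Subtype.ext h), mul_comm]
  have hsum : (β - α + α * Fintype.card K) * ∑ i, g i = 0 := by
    have h1 := Finset.sum_eq_zero fun j (_ : j ∈ Finset.univ) => key j
    rw [Finset.sum_add_distrib, ← Finset.mul_sum, Finset.sum_const, nsmul_eq_mul,
      Finset.card_univ] at h1
    linarith
  have hS : ∑ i, g i = 0 := by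
    refine (mul_eq_zero.1 hsum).resolve_left ?_
    have : 0 ≤ α * (Fintype.card K : ℝ) := by positivity
    linarith
  intro j
  have := key j
  rw [hS, mul_zero, add_zero] at this
  exact (mul_eq_zero.1 this).resolve_left (by linarith)

namespace IsSimplicialSystem

variable {n : ℕ} {X : Finset (Fin n → ℝ)} {α β : ℝ}

/-- If `f = m` at `x` and `y`, a relation `N.sum = c • (x + y)` would give `2cm ≤ N.length * m <
2cm`. So distinct points of the face have inner product `α` and are linearly independent. -/
theorem card_filter_le (h : IsSimplicialSystem X α β) (f : Module.Dual ℝ (Fin n → ℝ)) {m : ℝ}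
    (hm : 0 < m) (hf : ∀ x ∈ X, f x ≤ m) : (X.filter fun x => f x = m).card ≤ n := by
  have hli := linearIndependent_of_dotProduct_eq (K := X.filter fun x => f x = m) h.nonneg h.lt
    (fun x hx => h.norm x (Finset.mem_filter.1 hx).1) (fun x hx y hy hne => by
      rw [Finset.mem_filter] at hx hy
      refine ((h.pair x hx.1 y hy.1).resolve_left hne).resolve_right ?_
      rintro ⟨N, c, hN, hsum, hlen⟩
      have h1 : (N.map f).sum ≤ (N.map f).length • m :=
        List.sum_le_card_nsmul _ _ (by simpa using fun z hz => hf z (hN z hz))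
      rw [List.length_map, ← map_list_sum, hsum, map_smul, map_add, hx.2, hy.2, smul_eq_mul,
        nsmul_eq_mul] at h1
      nlinarith)
  simpa using hli.fintype_card_le_finrank

theorem dotProduct_le (h : IsSimplicialSystem X α β) {x y : Fin n → ℝ} (hx : x ∈ X) (hy : y ∈ X) :
    x ⬝ᵥ y ≤ β := by
  have h1 : 0 ≤ (x - y) ⬝ᵥ (x - y) := Finset.sum_nonneg fun i _ => mul_self_nonneg _
  rw [sub_dotProduct, dotProduct_sub, dotProduct_sub, h.norm x hx, h.norm y hy,
    dotProduct_comm y x] at h1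
  linarith

/-- Equality case of Cauchy–Schwarz: `|y - x|² ≤ β - 2β + β = 0`. -/
theorem eq_of_dotProduct_eq {x y : Fin n → ℝ} (hx : x ⬝ᵥ x = β) (hy : y ⬝ᵥ y ≤ β)
    (hxy : x ⬝ᵥ y = β) : y = x := by
  refine sub_eq_zero.1 (dotProduct_self_eq_zero.1 (le_antisymm ?_ (Finset.sum_nonneg fun i _ => mul_self_nonneg _)))
  rw [sub_dotProduct, dotProduct_sub, dotProduct_sub, hx, dotProduct_comm y x, hxy]
  linarith

theorem dotProduct_le_of_mem_convexHull (h : IsSimplicialSystem X α β) {x z : Fin n → ℝ}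
    (hx : x ∈ X) (hz : z ∈ convexHull ℝ (X : Set (Fin n → ℝ))) : x ⬝ᵥ z ≤ β := by
  have := le_of_mem_convexHull (-dotProductEquiv ℝ (Fin n) x) (c := -β)
    (fun y hy => by simpa using h.dotProduct_le hx hy) hz
  simpa using this

theorem dotProduct_self_le (h : IsSimplicialSystem X α β) {z : Fin n → ℝ}
    (hz : z ∈ convexHull ℝ (X : Set (Fin n → ℝ))) : z ⬝ᵥ z ≤ β := by
  have := le_of_mem_convexHull (-dotProductEquiv ℝ (Fin n) z) (c := -β)
    (fun y hy => by
      rw [LinearMap.neg_apply, dotProductEquiv_apply_apply, neg_le_neg_iff, dotProduct_comm]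
      exact h.dotProduct_le_of_mem_convexHull hy hz) hz
  simpa using this

theorem isAtomBounded (h : IsSimplicialSystem X α β) :
    IsAtomBounded (PolytopeFace (convexHull ℝ (X : Set (Fin n → ℝ)))) n := by
  intro G hG
  refine (PolytopeFace.encard_atoms_le (X.finite_toSet.isCompact_convexHull ℝ)
    extremePoints_convexHull_subset G).trans ?_
  rcases G.1.eq_empty_or_nonempty with he | hne
  · simp [he]
  obtain ⟨l, hl⟩ := G.2 hne
  obtain ⟨x₀, hx₀⟩ := hne
  rw [hl] at hx₀
  have hXQ : ∀ x ∈ X, x ∈ convexHull ℝ (X : Set (Fin n → ℝ)) := fun x hx =>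
    subset_convexHull ℝ _ hx
  -- If the maximum of `l` were not positive, central symmetry would make `l` non-negative on the
  -- hull, so the face would be everything.
  have hm : 0 < l x₀ := by
    by_contra! hm
    have hl0 : ∀ x ∈ convexHull ℝ (X : Set (Fin n → ℝ)), 0 ≤ l x := by
      intro x hx
      refine le_of_mem_convexHull l.toLinearMap (fun y hy => ?_) hx
      have := hx₀.2 (-y) (hXQ _ (h.neg y hy))
      rw [map_neg] at this
      simp only [ContinuousLinearMap.coe_coe]
      linarith
    refine hG (PolytopeFace.isMax_iff.2 (Set.Subset.antisymm G.2.subset fun x hx => ?_))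
    rw [hl]
    exact ⟨hx, fun y hy => ((hx₀.2 y hy).trans hm).trans (hl0 x hx)⟩
  refine le_trans ?_ (Nat.cast_le.2 (h.card_filter_le l.toLinearMap hm fun x hx =>
    hx₀.2 x (hXQ x hx)))
  rw [← Set.encard_coe_eq_coe_finsetCard]
  refine Set.encard_le_encard fun x hx => ?_
  have hxG := hx.2
  rw [hl] at hxG
  simp only [Finset.coe_filter]
  exact ⟨hx.1, le_antisymm (hx₀.2 x hxG.1) (hxG.2 x₀ hx₀.1)⟩

/-- The hull lies in the ball of squared radius `β`, so the form `x ⬝ᵥ ·` exposes each `x` in `X`.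
-/
theorem card_le_encard_atomSet (h : IsSimplicialSystem X α β) :
    (X.card : ℕ∞) ≤ (atomSet (PolytopeFace (convexHull ℝ (X : Set (Fin n → ℝ))))).encard := by
  have hex : ∀ x ∈ (X : Set (Fin n → ℝ)),
      ∃ F : PolytopeFace (convexHull ℝ (X : Set (Fin n → ℝ))), F.1 = {x} := by
    intro x hx
    have := isExposed_of_le (P := convexHull ℝ (X : Set (Fin n → ℝ)))
      (-dotProductEquiv ℝ (Fin n) x) (c := -β)
      (fun y hy => by simpa using h.dotProduct_le_of_mem_convexHull hx hy)
    refine ⟨⟨_, this⟩, Set.Subset.antisymm (fun y hy => ?_) ?_⟩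
    · have h1 : x ⬝ᵥ y = β := by simpa using hy.2
      exact eq_of_dotProduct_eq (h.norm x hx) (h.dotProduct_self_le hy.1) h1
    · rintro _ rfl
      exact ⟨subset_convexHull ℝ _ hx, by simpa using h.norm _ hx⟩
  have : Nonempty (PolytopeFace (convexHull ℝ (X : Set (Fin n → ℝ)))) := ⟨⟨_, IsExposed.refl _⟩⟩
  choose! f hf using hex
  rw [← Set.encard_coe_eq_coe_finsetCard]
  refine Set.encard_le_encard_of_injOn (f := f)
    (fun a ha => PolytopeFace.mem_atomSet_of_singleton (hf a ha)) fun a ha b hb hab => ?_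
  exact Set.singleton_injective ((hf a ha).symm.trans ((congrArg Subtype.val hab).trans (hf b hb)))

-- The point `β⁻¹ • v` of the polar lies on the facet of `v` and on no other.
open Classical in
theorem isFacetDescription (h : IsSimplicialSystem X α β) (hX : X.Nonempty) :
    IsFacetDescription (euclideanPolar (X : Set (Fin n → ℝ)))
      (X.image fun v => -dotProductEquiv ℝ (Fin n) v) where
  eq := by
    ext x
    simp [euclideanPolar, dotProduct_comm x]
  nonempty := hX.image _
  irredundant u hu w hw huw := by
    obtain ⟨v, hv, rfl⟩ := Finset.mem_image.1 hu
    obtain ⟨v', hv', rfl⟩ := Finset.mem_image.1 hw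
    have hβ : 0 < β := h.nonneg.trans_lt h.lt
    have h1 := huw (β⁻¹ • v) (fun y hy => by
      rw [smul_dotProduct, smul_eq_mul, inv_mul_le_iff₀ hβ, mul_one]
      exact h.dotProduct_le hv hy) (by simp [h.norm v hv, hβ.ne'])
    have h2 : v' ⬝ᵥ v = β := by
      simp only [LinearMap.neg_apply, dotProductEquiv_apply_apply, dotProduct_smul, smul_eq_mul,
        neg_inj] at h1
      rwa [inv_mul_eq_iff_eq_mul₀ hβ.ne', mul_one] at h1
    rw [eq_of_dotProduct_eq (h.norm v' hv') (h.norm v hv).le h2]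

/-- The facets of the polar through `x` correspond to the points of `X` with `x ⬝ᵥ y = 1`, where the
form given by `x` takes its upper bound 1. -/
theorem isAtomBounded_dual (h : IsSimplicialSystem X α β) (hX : X.Nonempty) :
    IsAtomBounded (PolytopeFace (euclideanPolar (X : Set (Fin n → ℝ))))ᵒᵈ n := by
  classical
  refine (h.isFacetDescription hX).isAtomBounded_dual fun x hx => ?_
  have h1 := h.card_filter_le (dotProductEquiv ℝ (Fin n) x) one_pos fun y hy => by
    simpa using hx y hy
  rw [Finset.filter_image]
  refine Finset.card_image_le.trans (le_trans (Finset.card_le_card fun y hy => ?_) h1)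
  simpa [dotProduct_comm x] using hy

theorem card_le_encard_atomSet_dual (h : IsSimplicialSystem X α β) (hX : X.Nonempty) :
    (X.card : ℕ∞) ≤ (atomSet (PolytopeFace (euclideanPolar (X : Set (Fin n → ℝ))))ᵒᵈ).encard := by
  classical
  rw [(h.isFacetDescription hX).encard_atomSet_dual, Finset.card_image_of_injective]
  exact neg_injective.comp (dotProductEquiv ℝ (Fin n)).injective

section Reflexive

variable {V : Type*} [NormedAddCommGroup V] [NormedSpace ℝ V] [FiniteDimensional ℝ V]
  [Nontrivial V] {L : Submodule ℤ V} {P : Set V}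

theorem not_combinatoriallyIsomorphic_convexHull (h : IsSimplicialSystem X α β)
    (hn : Module.finrank ℝ V = n) (hX : 3 * n < X.card) (hP : IsReflexivePolytope L P) :
    ¬CombinatoriallyIsomorphic P (convexHull ℝ (X : Set (Fin n → ℝ))) := by
  rintro ⟨e⟩
  obtain ⟨A, B, hAB⟩ := hP.exists_isVertexFacetPair
  have h1 := hAB.encard_atomSet_le (hn ▸ h.isAtomBounded.of_orderIso e)
  have h2 := (h.card_le_encard_atomSet.trans e.symm.encard_atomSet_le).trans h1
  rw [Nat.cast_le, hn] at h2
  omega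

theorem not_combinatoriallyIsomorphic_euclideanPolar (h : IsSimplicialSystem X α β)
    (hn : Module.finrank ℝ V = n) (hX : 3 * n < X.card) (hP : IsReflexivePolytope L P) :
    ¬CombinatoriallyIsomorphic P (euclideanPolar (X : Set (Fin n → ℝ))) := by
  rintro ⟨e⟩
  have hne : X.Nonempty := Finset.card_pos.1 (by omega)
  obtain ⟨A, B, hAB⟩ := hP.exists_isVertexFacetPair
  have h1 := hAB.encard_atomSet_dual_le (hn ▸ (h.isAtomBounded_dual hne).of_orderIso e.dual)
  have h2 := ((h.card_le_encard_atomSet_dual hne).trans e.dual.symm.encard_atomSet_le).trans h1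
  rw [Nat.cast_le, hn] at h2
  omega

end Reflexive

end IsSimplicialSystem

/-! ### Exact arithmetic in `ℤ[φ]` -/

/-- The real number `a + b * φ`. -/
noncomputable def goldVal (a : ℤ × ℤ) : ℝ := a.1 + a.2 * Real.goldenRatio

theorem goldVal_zero : goldVal (0, 0) = 0 := by simp [goldVal]

/-- Irrationality of `φ` makes equality of coordinates decidable on pairs of integers. -/
theorem goldVal_injective : Function.Injective goldVal := by
  rintro ⟨a, b⟩ ⟨a', b'⟩ h
  simp only [goldVal] at h
  have hb : b = b' := by
    by_contra hne
    refine (Real.goldenRatio_irrational.intCast_mul (sub_ne_zero.2 hne)).ne_int (a' - a) ?_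
    push_cast
    linarith
  subst hb
  have : (a : ℝ) = a' := by linarith
  rw [Int.cast_injective this]

/-- Multiplication in `ℤ[φ]`. -/
def goldMul (a b : ℤ × ℤ) : ℤ × ℤ :=
  (a.1 * b.1 + a.2 * b.2, a.1 * b.2 + a.2 * b.1 + a.2 * b.2)

theorem goldVal_goldMul (a b : ℤ × ℤ) : goldVal (goldMul a b) = goldVal a * goldVal b := by
  simp only [goldVal, goldMul]
  push_cast
  linear_combination (-(a.2 : ℝ) * b.2) * Real.goldenRatio_sq

/-- The vector with the given coordinates in `ℤ[φ]`. -/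
noncomputable def goldVec (n : ℕ) (l : List (ℤ × ℤ)) : Fin n → ℝ :=
  fun i => goldVal (l.getD i (0, 0))

theorem goldVec_succ_cons (n : ℕ) (a : ℤ × ℤ) (l : List (ℤ × ℤ)) :
    goldVec (n + 1) (a :: l) = Fin.cons (goldVal a) (goldVec n l) := by
  ext i
  refine Fin.cases ?_ (fun i => ?_) i <;> simp [goldVec]

theorem eq_of_goldVec_eq {n : ℕ} {l l' : List (ℤ × ℤ)} (hl : l.length = n) (hl' : l'.length = n)
    (h : goldVec n l = goldVec n l') : l = l' := by
  refine List.ext_getElem (hl.trans hl'.symm) fun i h1 h2 => ?_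
  have := goldVal_injective (congrFun h ⟨i, hl ▸ h1⟩)
  simpa [List.getD_eq_getElem, h1, h2] using this

/-- The dot product of two vectors over `ℤ[φ]`. -/
def goldDot : List (ℤ × ℤ) → List (ℤ × ℤ) → ℤ × ℤ
  | a :: l, b :: l' => ((goldMul a b).1 + (goldDot l l').1, (goldMul a b).2 + (goldDot l l').2)
  | _, _ => (0, 0)

theorem goldVec_dotProduct {n : ℕ} {l l' : List (ℤ × ℤ)} (hl : l.length = n)
    (hl' : l'.length = n) : goldVec n l ⬝ᵥ goldVec n l' = goldVal (goldDot l l') := by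
  induction n generalizing l l' with
  | zero =>
    rw [List.length_eq_zero_iff.1 hl]
    simp [goldDot, goldVal_zero]
  | succ n ih =>
    obtain ⟨a, l, rfl⟩ := List.exists_cons_of_length_eq_add_one hl
    obtain ⟨b, l', rfl⟩ := List.exists_cons_of_length_eq_add_one hl'
    have h := ih (l := l) (l' := l') (by simpa using hl) (by simpa using hl')
    rw [goldVec_succ_cons, goldVec_succ_cons, dotProduct, Fin.sum_univ_succ]
    simp only [Fin.cons_zero, Fin.cons_succ]
    rw [← dotProduct, h, ← goldVal_goldMul]
    simp only [goldDot, goldVal]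
    push_cast
    ring

/-- Addition of two vectors over `ℤ[φ]`. -/
def goldAdd (l l' : List (ℤ × ℤ)) : List (ℤ × ℤ) :=
  List.zipWith (fun a b => (a.1 + b.1, a.2 + b.2)) l l'

theorem length_goldAdd {n : ℕ} {l l' : List (ℤ × ℤ)} (hl : l.length = n) (hl' : l'.length = n) :
    (goldAdd l l').length = n := by
  simp [goldAdd, hl, hl']

theorem goldVec_goldAdd {n : ℕ} {l l' : List (ℤ × ℤ)} (hl : l.length = n)
    (hl' : l'.length = n) : goldVec n (goldAdd l l') = goldVec n l + goldVec n l' := by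
  ext i
  have h1 : (i : ℕ) < l.length := hl ▸ i.2
  have h2 : (i : ℕ) < l'.length := hl' ▸ i.2
  simp only [goldVec, goldAdd, Pi.add_apply, goldVal]
  rw [List.getD_eq_getElem _ _ (by simp [h1, h2]), List.getD_eq_getElem _ _ h1,
    List.getD_eq_getElem _ _ h2, List.getElem_zipWith]
  push_cast
  ring

theorem goldVec_map_goldMul (n : ℕ) (c : ℤ × ℤ) (l : List (ℤ × ℤ)) :
    goldVec n (l.map (goldMul c)) = goldVal c • goldVec n l := by
  ext i
  simp only [goldVec, Pi.smul_apply, smul_eq_mul]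
  rw [← goldVal_goldMul, ← List.getD_map (f := goldMul c)]
  simp [goldMul]

/-- The sum of a list of vectors over `ℤ[φ]`. -/
def goldSum (n : ℕ) (N : List (List (ℤ × ℤ))) : List (ℤ × ℤ) :=
  N.foldr goldAdd (List.replicate n (0, 0))

theorem goldVec_goldSum {n : ℕ} {N : List (List (ℤ × ℤ))} (hN : ∀ l ∈ N, l.length = n) :
    (goldSum n N).length = n ∧ goldVec n (goldSum n N) = (N.map (goldVec n)).sum := by
  induction N with
  | nil =>
    refine ⟨by simp [goldSum], ?_⟩
    ext i
    simp [goldSum, goldVec, goldVal_zero]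
  | cons l N ih =>
    obtain ⟨h1, h2⟩ := ih fun l' hl' => hN l' (List.mem_cons_of_mem _ hl')
    have hl := hN l List.mem_cons_self
    refine ⟨length_goldAdd hl h1, ?_⟩
    rw [List.map_cons, List.sum_cons, ← h2, ← goldVec_goldAdd hl h1]
    rfl

/-! ### Signed even permutations as lists -/

/-- All vectors obtained by sign changes. -/
def goldSigned : List (ℤ × ℤ) → List (List (ℤ × ℤ))
  | [] => [[]]
  | a :: l => (goldSigned l).flatMap fun m =>
      if a = (0, 0) then [a :: m] else [a :: m, (-a.1, -a.2) :: m]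

theorem exists_sign_of_mem_goldSigned {l m : List (ℤ × ℤ)} (hm : m ∈ goldSigned l) :
    ∃ s : ℕ → ℝ, (∀ i, s i = 1 ∨ s i = -1) ∧
      ∀ i, goldVal (m.getD i (0, 0)) = s i * goldVal (l.getD i (0, 0)) := by
  induction l generalizing m with
  | nil =>
    refine ⟨fun _ => 1, by simp, ?_⟩
    simp_all [goldSigned]
  | cons a l ih =>
    simp only [goldSigned, List.mem_flatMap] at hm
    obtain ⟨m', hm', hm⟩ := hm
    obtain ⟨s, hs, h⟩ := ih hm'
    have hm : m = a :: m' ∨ m = (-a.1, -a.2) :: m' := by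
      split_ifs at hm
      · exact Or.inl (List.mem_singleton.1 hm)
      · exact List.mem_pair.1 hm
    rcases hm with rfl | rfl
    · refine ⟨fun i => Nat.casesOn i 1 s, fun i => ?_, fun i => ?_⟩
      · cases i with
        | zero => simp
        | succ i => exact hs i
      · cases i with
        | zero => simp
        | succ i => simpa using h i
    · refine ⟨fun i => Nat.casesOn i (-1) s, fun i => ?_, fun i => ?_⟩
      · cases i with
        | zero => simp
        | succ i => exact hs i
      · cases i with
        | zero => simp [goldVal]; ring
        | succ i => simpa using h i

theorem exists_mem_goldSigned (l : List (ℤ × ℤ)) {s : ℕ → ℝ} (hs : ∀ i, s i = 1 ∨ s i = -1) :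
    ∃ m ∈ goldSigned l, ∀ i, goldVal (m.getD i (0, 0)) = s i * goldVal (l.getD i (0, 0)) := by
  induction l generalizing s with
  | nil => exact ⟨[], by simp [goldSigned], by simp [goldVal_zero]⟩
  | cons a l ih =>
    obtain ⟨m, hm, h⟩ := ih (s := fun i => s (i + 1)) fun i => hs _
    have key : ∀ b : ℤ × ℤ, goldVal b = s 0 * goldVal a → ∀ i,
        goldVal ((b :: m).getD i (0, 0)) = s i * goldVal ((a :: l).getD i (0, 0)) := by
      intro b hb i
      cases i with
      | zero => simpa using hb
      | succ i => simpa using h i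
    simp only [goldSigned, List.mem_flatMap]
    by_cases ha : a = (0, 0)
    · refine ⟨a :: m, ⟨m, hm, by simp [ha]⟩, key a ?_⟩
      rw [ha, goldVal_zero, mul_zero]
    · rcases hs 0 with h0 | h0
      · exact ⟨a :: m, ⟨m, hm, by simp [ha]⟩, key a (by rw [h0, one_mul])⟩
      · refine ⟨(-a.1, -a.2) :: m, ⟨m, hm, by simp [ha]⟩, key _ ?_⟩
        rw [h0]
        simp [goldVal]
        ring

/-- `E` is a list of the even permutations of `l`. -/
def IsEvenPermList (n : ℕ) (l : List (ℤ × ℤ)) (E : List (List (ℤ × ℤ))) : Prop :=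
  (∀ σ : Equiv.Perm (Fin n), Equiv.Perm.sign σ = 1 →
    List.ofFn (fun i => l.getD (σ i) (0, 0)) ∈ E) ∧
  ∀ b ∈ E, ∃ σ : Equiv.Perm (Fin n), Equiv.Perm.sign σ = 1 ∧
    b = List.ofFn (fun i => l.getD (σ i) (0, 0))

instance (n : ℕ) (l : List (ℤ × ℤ)) (E : List (List (ℤ × ℤ))) : Decidable (IsEvenPermList n l E) :=
  inferInstanceAs (Decidable (_ ∧ _))

theorem IsEvenPermList.mem_iff {n : ℕ} {l : List (ℤ × ℤ)} {E : List (List (ℤ × ℤ))}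
    (h : IsEvenPermList n l E) {x : Fin n → ℝ} :
    x ∈ evenSignedPermutations (goldVec n l) ↔
      ∃ m ∈ E.flatMap goldSigned, x = goldVec n m := by
  have hget : ∀ (σ : Equiv.Perm (Fin n)) (i : Fin n),
      (List.ofFn (fun i => l.getD (σ i) (0, 0))).getD i (0, 0) = l.getD (σ i) (0, 0) := by
    intro σ i
    rw [List.getD_eq_getElem _ _ (by simp), List.getElem_ofFn]
  constructor
  · rintro ⟨σ, hσ, s, hs, rfl⟩
    obtain ⟨m, hm, hms⟩ := exists_mem_goldSigned (List.ofFn (fun i => l.getD (σ i) (0, 0)))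
      -- Positions beyond `n` are never read; the sign 1 there only makes the function total.
      (s := fun i => if h : i < n then s ⟨i, h⟩ else 1) (fun i => by
        by_cases hi : i < n
        · simpa [hi] using hs ⟨i, hi⟩
        · simp [hi])
    refine ⟨m, List.mem_flatMap.2 ⟨_, h.1 σ (Equiv.Perm.mem_alternatingGroup.1 hσ), hm⟩, ?_⟩
    ext i
    have := hms i
    rw [hget] at this
    simpa [goldVec] using this.symm
  · rintro ⟨m, hm, rfl⟩
    obtain ⟨b, hb, hm⟩ := List.mem_flatMap.1 hm
    obtain ⟨σ, hσ, rfl⟩ := h.2 b hb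
    obtain ⟨s, hs, hms⟩ := exists_sign_of_mem_goldSigned hm
    refine ⟨σ, Equiv.Perm.mem_alternatingGroup.2 hσ, fun i => s i, fun i => hs i, ?_⟩
    ext i
    have := hms i
    rw [hget] at this
    exact this

theorem neg_mem_evenSignedPermutations {n : ℕ} {a x : Fin n → ℝ}
    (hx : x ∈ evenSignedPermutations a) : -x ∈ evenSignedPermutations a := by
  obtain ⟨σ, hσ, s, hs, rfl⟩ := hx
  refine ⟨σ, hσ, fun i => -s i, fun i => ?_, ?_⟩
  · rcases hs i with h | h <;> simp [h]
  · ext i; simp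

/-- Even signed permutations act transitively by isometries on each of their orbits. -/
theorem exists_isometry_of_mem_evenSignedPermutations {n : ℕ} {a x : Fin n → ℝ}
    (hx : x ∈ evenSignedPermutations a) :
    ∃ T : (Fin n → ℝ) →ₗ[ℝ] (Fin n → ℝ), T a = x ∧ (∀ y z, T y ⬝ᵥ T z = y ⬝ᵥ z) ∧
      ∀ b y, (y ∈ evenSignedPermutations b → T y ∈ evenSignedPermutations b ∧
        ∃ y' ∈ evenSignedPermutations b, T y' = y) := by
  obtain ⟨σ, hσ, s, hs, rfl⟩ := hx
  have hss : ∀ i, s i * s i = 1 := fun i => by rcases hs i with h | h <;> simp [h]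
  -- `T` is the signed permutation matrix of `σ` and `s`; the preimage below uses `σ⁻¹` with the
  -- signs moved along, and `s i * s i = 1`.
  refine ⟨LinearMap.pi fun i => s i • LinearMap.proj (σ i), ?_, fun y z => ?_, ?_⟩
  · ext i; simp
  · simp only [dotProduct, LinearMap.pi_apply, LinearMap.smul_apply, LinearMap.proj_apply,
      smul_eq_mul]
    rw [← Equiv.sum_comp σ fun i => y i * z i]
    exact Finset.sum_congr rfl fun i _ => by linear_combination (y (σ i) * z (σ i)) * hss i
  · rintro b _ ⟨τ, hτ, t, ht, rfl⟩
    have hsign : ∀ {s t : ℝ}, (s = 1 ∨ s = -1) → (t = 1 ∨ t = -1) → s * t = 1 ∨ s * t = -1 := by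
      rintro s t (rfl | rfl) (rfl | rfl) <;> simp
    refine ⟨⟨τ * σ, mul_mem hτ hσ, fun i => s i * t (σ i), fun i => hsign (hs _) (ht _), ?_⟩,
      fun i => s (σ⁻¹ i) * t (σ⁻¹ i) * b (τ (σ⁻¹ i)), ⟨τ * σ⁻¹, mul_mem hτ (inv_mem hσ),
      fun i => s (σ⁻¹ i) * t (σ⁻¹ i), fun i => hsign (hs _) (ht _), ?_⟩, ?_⟩
    · ext i; simp [mul_assoc]
    · ext i; simp
    · ext i
      simp only [LinearMap.pi_apply, LinearMap.smul_apply, LinearMap.proj_apply, smul_eq_mul]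
      rw [show σ⁻¹ (σ i) = i from σ.symm_apply_apply i]
      linear_combination (t i * b (τ i)) * hss i

/-! ### Checking the relations at orbit representatives -/

/-- Tests whether the vectors of `L` whose dot product with `s` is `k` add up to
`c • s`, where `c` is more than half of their number. -/
def isRelation (n : ℕ) (L : List (List (ℤ × ℤ))) (s : List (ℤ × ℤ)) (k c : ℤ × ℤ) : Bool :=
  let N := L.filter fun z => goldDot z s == k
  decide (0 ≤ c.2) && decide (5 * (N.length : ℤ) < 10 * c.1 + 16 * c.2) &&
    goldSum n N == s.map (goldMul c)

/-- Tests whether `x` and `y` are equal, have dot product `α`, or satisfy a relation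
from the table `tab`, which is indexed by dot products. -/
def isRelatedPair (n : ℕ) (L : List (List (ℤ × ℤ))) (tab : List ((ℤ × ℤ) × (ℤ × ℤ) × (ℤ × ℤ)))
    (α : ℤ × ℤ) (x y : List (ℤ × ℤ)) : Bool :=
  x == y || goldDot x y == α ||
    tab.any fun r => goldDot x y == r.1 && isRelation n L (goldAdd x y) r.2.1 r.2.2

theorem goldVec_of_isRelatedPair {n : ℕ} {L : List (List (ℤ × ℤ))} (hL : ∀ l ∈ L, l.length = n)
    {tab : List ((ℤ × ℤ) × (ℤ × ℤ) × (ℤ × ℤ))} {α : ℤ × ℤ} {x y : List (ℤ × ℤ)}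
    (hx : x.length = n) (hy : y.length = n) (h : isRelatedPair n L tab α x y = true) :
    goldVec n x = goldVec n y ∨ goldVec n x ⬝ᵥ goldVec n y = goldVal α ∨
      ∃ N : List (Fin n → ℝ), ∃ c : ℝ, (∀ z ∈ N, ∃ m ∈ L, z = goldVec n m) ∧
        N.sum = c • (goldVec n x + goldVec n y) ∧ (N.length : ℝ) < 2 * c := by
  simp only [isRelatedPair, isRelation, Bool.or_eq_true, Bool.and_eq_true, List.any_eq_true,
    beq_iff_eq, decide_eq_true_eq] at h
  rcases h with (h | h) | ⟨r, -, -, ⟨h1, h2⟩, h3⟩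
  · exact Or.inl (h ▸ rfl)
  · refine Or.inr (Or.inl ?_)
    rw [goldVec_dotProduct hx hy, h]
  · refine Or.inr (Or.inr ?_)
    set N := L.filter fun z => goldDot z (goldAdd x y) == r.2.1
    have hN : ∀ l ∈ N, l ∈ L := fun l hl => (List.mem_filter.1 hl).1
    refine ⟨N.map (goldVec n), goldVal r.2.2, fun z hz => ?_, ?_, ?_⟩
    · obtain ⟨m, hm, rfl⟩ := List.mem_map.1 hz
      exact ⟨m, hN m hm, rfl⟩
    · rw [← (goldVec_goldSum fun l hl => hL l (hN l hl)).2, h3, goldVec_map_goldMul,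
        goldVec_goldAdd hx hy]
    · have h2' : (5 * N.length : ℝ) < 10 * r.2.2.1 + 16 * r.2.2.2 := by exact_mod_cast h2
      have h1' : (0 : ℝ) ≤ r.2.2.2 := by exact_mod_cast h1
      -- With `φ ≥ 8/5`, the integer test `5 * length < 10 * c.1 + 16 * c.2` implies `length < 2 *
      -- c`, provided `c.2 ≥ 0`.
      have hφ : (8 / 5 : ℝ) ≤ Real.goldenRatio := by
        have : (11 / 5 : ℝ) ≤ √5 := Real.le_sqrt_of_sq_le (by norm_num)
        rw [Real.goldenRatio]
        linarith
      rw [List.length_map, goldVal]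
      nlinarith [mul_le_mul_of_nonneg_left hφ h1']

open Classical in
/-- Unions of orbits of even signed permutations are simplicial systems if the finitely many
relations can be checked at representatives of the orbits. -/
theorem isSimplicialSystem_of_isRelatedPair {n : ℕ} {L R : List (List (ℤ × ℤ))}
    (hL : ∀ l ∈ L, l.length = n) (hR : ∀ l ∈ R, l.length = n)
    (hLR : ∀ x, (∃ m ∈ L, x = goldVec n m) ↔ ∃ l ∈ R, x ∈ evenSignedPermutations (goldVec n l))
    {tab : List ((ℤ × ℤ) × (ℤ × ℤ) × (ℤ × ℤ))} {α β : ℤ × ℤ} (hα : 0 ≤ goldVal α)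
    (hαβ : goldVal α < goldVal β) (hβ : ∀ l ∈ R, goldDot l l = β)
    (h : ∀ x ∈ R, ∀ y ∈ L, isRelatedPair n L tab α x y = true) :
    IsSimplicialSystem (L.toFinset.image (goldVec n)) (goldVal α) (goldVal β) := by
  have hmem : ∀ x, x ∈ L.toFinset.image (goldVec n) ↔
      ∃ l ∈ R, x ∈ evenSignedPermutations (goldVec n l) := by
    intro x
    rw [← hLR]
    simp [eq_comm]
  refine ⟨hα, hαβ, fun x hx => ?_, fun x hx => ?_, fun x hx y hy => ?_⟩
  · obtain ⟨l, hl, hx⟩ := (hmem x).1 hx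
    obtain ⟨T, rfl, hT, -⟩ := exists_isometry_of_mem_evenSignedPermutations hx
    rw [hT, goldVec_dotProduct (hR l hl) (hR l hl), hβ l hl]
  · obtain ⟨l, hl, hx⟩ := (hmem x).1 hx
    exact (hmem _).2 ⟨l, hl, neg_mem_evenSignedPermutations hx⟩
  · obtain ⟨l, hl, hx⟩ := (hmem x).1 hx
    obtain ⟨l', hl', hy⟩ := (hmem y).1 hy
    -- An isometry preserving all the orbits moves `x` to its representative, so only the second
    -- vector has to range over `L`.
    obtain ⟨T, rfl, hT, hTm⟩ := exists_isometry_of_mem_evenSignedPermutations hx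
    obtain ⟨y, hy', rfl⟩ := (hTm _ _ hy).2
    obtain ⟨m, hm, rfl⟩ := (hLR y).2 ⟨l', hl', hy'⟩
    rcases goldVec_of_isRelatedPair hL (hR l hl) (hL m hm) (h l hl m hm) with
      h1 | h1 | ⟨N, c, hN, hsum, hlen⟩
    · exact Or.inl (congrArg T h1)
    · exact Or.inr (Or.inl ((hT _ _).trans h1))
    · refine Or.inr (Or.inr ⟨N.map T, c, fun z hz => ?_, ?_, by simpa using hlen⟩)
      · obtain ⟨w, hw, rfl⟩ := List.mem_map.1 hz
        obtain ⟨l'', hl'', hw⟩ := (hLR w).1 (hN w hw)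
        exact (hmem _).2 ⟨l'', hl'', (hTm _ _ hw).1⟩
      · rw [← map_list_sum, hsum, map_smul, map_add]

open Classical in
theorem card_image_goldVec {n : ℕ} {L : List (List (ℤ × ℤ))} (hL : ∀ l ∈ L, l.length = n)
    (hd : L.Nodup) : (L.toFinset.image (goldVec n)).card = L.length := by
  rw [Finset.card_image_of_injOn, List.toFinset_card_of_nodup hd]
  intro l hl l' hl' he
  exact eq_of_goldVec_eq (hL l (by simpa using hl)) (hL l' (by simpa using hl')) he

/-! ### The icosahedron and the 600-cell -/

/-- Vertices of the icosahedron up to sign changes. -/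
def icosahedronShapes : List (List (ℤ × ℤ)) :=
  [[(0, 0), (1, 0), (0, 1)], [(1, 0), (0, 1), (0, 0)], [(0, 1), (0, 0), (1, 0)]]

theorem isEvenPermList_icosahedron :
    IsEvenPermList 3 [(0, 0), (1, 0), (0, 1)] icosahedronShapes := by
  decide +kernel

theorem icosahedronVertices_eq :
    icosahedronVertices = evenSignedPermutations (goldVec 3 [(0, 0), (1, 0), (0, 1)]) := by
  rw [icosahedronVertices]
  congr 1
  ext i
  fin_cases i <;> simp [goldVec, goldVal]

open Classical in
theorem exists_isSimplicialSystem_icosahedron : ∃ X : Finset (Fin 3 → ℝ), ∃ α β : ℝ,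
    IsSimplicialSystem X α β ∧ (X : Set (Fin 3 → ℝ)) = icosahedronVertices ∧ 3 * 3 < X.card := by
  have hlen : ∀ l ∈ icosahedronShapes.flatMap goldSigned, l.length = 3 := by decide +kernel
  refine ⟨(icosahedronShapes.flatMap goldSigned).toFinset.image (goldVec 3), goldVal (0, 1),
    goldVal (2, 1), isSimplicialSystem_of_isRelatedPair (R := [[(0, 0), (1, 0), (0, 1)]])
      -- At inner product `-φ`, the two common neighbours of `x` and `y` sum to `φ • (x + y)`, and
      -- `2 < 2φ`. For antipodes `x + y = 0`, and the empty sum serves with `c = 1`.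
      (tab := [((0, -1), (0, 2), (0, 1)), ((-2, -1), (1, 0), (1, 0))]) hlen (by simp)
      (fun x => ?_) ?_ ?_ (by decide +kernel) (by decide +kernel), ?_, ?_⟩
  · simp [isEvenPermList_icosahedron.mem_iff]
  · simp [goldVal, Real.goldenRatio_pos.le]
  · simp [goldVal]
  · ext x
    rw [icosahedronVertices_eq, isEvenPermList_icosahedron.mem_iff]
    simp [eq_comm]
  · rw [card_image_goldVec hlen (by decide +kernel)]
    decide +kernel

/-- Vertices of the 600-cell up to sign changes and even permutations. -/
def cell600Representatives : List (List (ℤ × ℤ)) :=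
  [[(2, 0), (0, 0), (0, 0), (0, 0)], [(1, 0), (1, 0), (1, 0), (1, 0)],
    [(0, 1), (1, 0), (-1, 1), (0, 0)]]

/-- The permutations of `(2, 0, 0, 0)`. -/
def cell600ShapesAxis : List (List (ℤ × ℤ)) :=
  [[(2, 0), (0, 0), (0, 0), (0, 0)], [(0, 0), (2, 0), (0, 0), (0, 0)],
    [(0, 0), (0, 0), (2, 0), (0, 0)], [(0, 0), (0, 0), (0, 0), (2, 0)]]

/-- The even permutations of `(φ, 1, φ⁻¹, 0)`. -/
def cell600ShapesGolden : List (List (ℤ × ℤ)) :=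
  [[0, 1, 2, 3], [0, 2, 3, 1], [0, 3, 1, 2], [1, 0, 3, 2], [1, 2, 0, 3], [1, 3, 2, 0],
    [2, 0, 1, 3], [2, 1, 3, 0], [2, 3, 0, 1], [3, 0, 2, 1], [3, 1, 0, 2], [3, 2, 1, 0]].map
    fun p => p.map fun i => [(0, 1), (1, 0), (-1, 1), (0, 0)].getD i (0, 0)

/-- Vertices of the 600-cell up to sign changes. -/
def cell600Shapes : List (List (ℤ × ℤ)) :=
  cell600ShapesAxis ++ [[(1, 0), (1, 0), (1, 0), (1, 0)]] ++ cell600ShapesGolden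

theorem isEvenPermList_axis :
    IsEvenPermList 4 [(2, 0), (0, 0), (0, 0), (0, 0)] cell600ShapesAxis := by
  decide +kernel

theorem isEvenPermList_ones :
    IsEvenPermList 4 [(1, 0), (1, 0), (1, 0), (1, 0)] [[(1, 0), (1, 0), (1, 0), (1, 0)]] := by
  decide +kernel

theorem isEvenPermList_golden :
    IsEvenPermList 4 [(0, 1), (1, 0), (-1, 1), (0, 0)] cell600ShapesGolden := by
  decide +kernel

theorem cell600Vertices_eq : cell600Vertices =
    {x | ∃ l ∈ cell600Representatives, x ∈ evenSignedPermutations (goldVec 4 l)} := by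
  have h1 : goldVec 4 [(2, 0), (0, 0), (0, 0), (0, 0)] = ![2, 0, 0, 0] := by
    ext i
    fin_cases i <;> simp [goldVec, goldVal]
  have h2 : goldVec 4 [(1, 0), (1, 0), (1, 0), (1, 0)] = ![1, 1, 1, 1] := by
    ext i
    fin_cases i <;> simp [goldVec, goldVal]
  have h3 : goldVec 4 [(0, 1), (1, 0), (-1, 1), (0, 0)] =
      ![Real.goldenRatio, 1, Real.goldenRatio⁻¹, 0] := by
    have : Real.goldenRatio⁻¹ = -1 + Real.goldenRatio := by
      rw [Real.inv_goldenRatio]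
      linarith [Real.goldenRatio_add_goldenConj]
    ext i
    fin_cases i <;> simp [goldVec, goldVal, this]
  ext x
  simp [cell600Vertices, cell600Representatives, h1, h2, h3, or_assoc]

theorem mem_cell600Vertices_iff {x : Fin 4 → ℝ} : x ∈ cell600Vertices ↔
    ∃ m ∈ cell600Shapes.flatMap goldSigned, x = goldVec 4 m := by
  have h : ∀ E E' : List (List (ℤ × ℤ)), (∃ m ∈ (E ++ E').flatMap goldSigned, x = goldVec 4 m) ↔
      (∃ m ∈ E.flatMap goldSigned, x = goldVec 4 m) ∨
        ∃ m ∈ E'.flatMap goldSigned, x = goldVec 4 m := by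
    intro E E'
    rw [List.flatMap_append]
    simp only [List.mem_append, or_and_right, exists_or]
  rw [cell600Shapes, h, h, ← isEvenPermList_axis.mem_iff, ← isEvenPermList_ones.mem_iff,
    ← isEvenPermList_golden.mem_iff, cell600Vertices_eq]
  simp [cell600Representatives, or_assoc]

set_option maxRecDepth 10000 in
open Classical in
theorem exists_isSimplicialSystem_cell600 : ∃ X : Finset (Fin 4 → ℝ), ∃ α β : ℝ,
    IsSimplicialSystem X α β ∧ (X : Set (Fin 4 → ℝ)) = cell600Vertices ∧ 3 * 4 < X.card := by
  have hlen : ∀ l ∈ cell600Shapes.flatMap goldSigned, l.length = 4 := by decide +kernel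
  refine ⟨(cell600Shapes.flatMap goldSigned).toFinset.image (goldVec 4), goldVal (0, 2),
    goldVal (4, 0), isSimplicialSystem_of_isRelatedPair (R := cell600Representatives)
      -- One row for each inner product other than `4` and the edge value `2φ`. At inner product 2,
      -- for instance, three common neighbours sum to `φ • (x + y)`, and `3 < 2φ`; in the last row
      -- `x + y = 0`.
      (tab := [((2, 0), (0, 4), (0, 1)), ((-2, 2), (0, 4), (-1, 1)), ((0, 0), (2, 2), (1, 1)),
        ((2, -2), (-2, 4), (0, 1)), ((-2, 0), (4, 0), (1, 0)), ((0, -2), (-4, 4), (0, 1)),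
        ((-4, 0), (1, 0), (1, 0))]) hlen (by decide +kernel)
      (fun x => ?_) ?_ ?_ (by decide +kernel) (by decide +kernel), ?_, ?_⟩
  · rw [← mem_cell600Vertices_iff, cell600Vertices_eq]
    rfl
  · simp [goldVal, Real.goldenRatio_pos.le]
  · have := Real.goldenRatio_lt_two
    simp [goldVal]
    linarith
  · ext x
    rw [mem_cell600Vertices_iff]
    simp [eq_comm]
  · rw [card_image_goldVec hlen (by decide +kernel)]
    decide +kernel

/-! ### Maps that preserve the face lattice -/

theorem CombinatoriallyIsomorphic.symm {V W : Type*} [AddCommGroup V] [Module ℝ V]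
    [TopologicalSpace V] [AddCommGroup W] [Module ℝ W] [TopologicalSpace W] {P : Set V}
    {Q : Set W} : CombinatoriallyIsomorphic P Q → CombinatoriallyIsomorphic Q P :=
  fun ⟨e⟩ => ⟨e.symm⟩

theorem CombinatoriallyIsomorphic.trans {V W U : Type*} [AddCommGroup V] [Module ℝ V]
    [TopologicalSpace V] [AddCommGroup W] [Module ℝ W] [TopologicalSpace W] [AddCommGroup U]
    [Module ℝ U] [TopologicalSpace U] {P : Set V} {Q : Set W} {R : Set U} :
    CombinatoriallyIsomorphic P Q → CombinatoriallyIsomorphic Q R →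
      CombinatoriallyIsomorphic P R :=
  fun ⟨e⟩ ⟨e'⟩ => ⟨e.trans e'⟩

/-- A map that is injective on `P` and along which linear forms correspond up to constants
preserves the face lattice. -/
theorem combinatoriallyIsomorphic_image {V W : Type*} [AddCommGroup V] [Module ℝ V]
    [TopologicalSpace V] [AddCommGroup W] [Module ℝ W] [TopologicalSpace W] {P : Set V}
    (f : V → W) (hf : Set.InjOn f P)
    (h1 : ∀ l : StrongDual ℝ W, ∃ l' : StrongDual ℝ V, ∃ c, ∀ x ∈ P, l (f x) = l' x + c)
    (h2 : ∀ l' : StrongDual ℝ V, ∃ l : StrongDual ℝ W, ∃ c, ∀ x ∈ P, l (f x) = l' x + c) :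
    CombinatoriallyIsomorphic P (f '' P) := by
  have himg : ∀ F : Set V, IsExposed ℝ P F → IsExposed ℝ (f '' P) (f '' F) := by
    rintro F hF ⟨_, x₀, hx₀, rfl⟩
    obtain ⟨l', hl'⟩ := hF ⟨x₀, hx₀⟩
    obtain ⟨l, c, hl⟩ := h2 l'
    refine ⟨l, Set.ext fun z => ⟨?_, ?_⟩⟩
    · rintro ⟨x, hx, rfl⟩
      rw [hl'] at hx
      refine ⟨⟨x, hx.1, rfl⟩, ?_⟩
      rintro _ ⟨y, hy, rfl⟩
      rw [hl x hx.1, hl y hy]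
      have := hx.2 y hy
      linarith
    · rintro ⟨⟨x, hx, rfl⟩, hmax⟩
      refine ⟨x, ?_, rfl⟩
      rw [hl']
      refine ⟨hx, fun y hy => ?_⟩
      have := hmax (f y) ⟨y, hy, rfl⟩
      rw [hl x hx, hl y hy] at this
      linarith
  have hpre : ∀ G : Set W, IsExposed ℝ (f '' P) G → IsExposed ℝ P (P ∩ f ⁻¹' G) := by
    rintro G hG ⟨x₀, hx₀P, hx₀⟩
    obtain ⟨l, hGl⟩ := hG ⟨f x₀, hx₀⟩
    obtain ⟨l', c, hl⟩ := h1 l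
    refine ⟨l', Set.ext fun x => and_congr_right fun hx => ?_⟩
    rw [Set.mem_preimage, hGl]
    constructor
    · intro h y hy
      have := h.2 (f y) ⟨y, hy, rfl⟩
      rw [hl x hx, hl y hy] at this
      linarith
    · intro h
      refine ⟨⟨x, hx, rfl⟩, ?_⟩
      rintro _ ⟨y, hy, rfl⟩
      rw [hl x hx, hl y hy]
      have := h y hy
      linarith
  exact ⟨{
    toFun := fun F => ⟨f '' F.1, himg F.1 F.2⟩
    invFun := fun G => ⟨P ∩ f ⁻¹' G.1, hpre G.1 G.2⟩
    left_inv := by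
      rintro ⟨F, hF⟩
      refine Subtype.ext (Set.Subset.antisymm ?_ fun x hx => ⟨hF.subset hx, x, hx, rfl⟩)
      rintro x ⟨hx, y, hy, he⟩
      rwa [← hf (hF.subset hy) hx he]
    right_inv := by
      rintro ⟨G, hG⟩
      refine Subtype.ext (Set.Subset.antisymm ?_ fun z hz => ?_)
      · rintro _ ⟨x, ⟨-, hx⟩, rfl⟩
        exact hx
      · obtain ⟨x, hx, rfl⟩ := hG.subset hz
        exact ⟨x, ⟨hx, hz⟩, rfl⟩
    map_rel_iff' := by
      rintro ⟨F, hF⟩ ⟨F', hF'⟩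
      refine ⟨fun h x hx => ?_, fun h => Set.image_mono h⟩
      obtain ⟨y, hy, he⟩ := h ⟨x, hx, rfl⟩
      rwa [← hf (hF'.subset hy) (hF.subset hx) he] }⟩

theorem combinatoriallyIsomorphic_image_linearEquiv {V W : Type*} [NormedAddCommGroup V]
    [NormedSpace ℝ V] [FiniteDimensional ℝ V] [NormedAddCommGroup W] [NormedSpace ℝ W]
    [FiniteDimensional ℝ W] (e : V ≃ₗ[ℝ] W) (P : Set V) :
    CombinatoriallyIsomorphic P (e '' P) := by
  refine combinatoriallyIsomorphic_image e e.injective.injOn (fun l => ?_) fun l => ?_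
  · exact ⟨l.comp (LinearMap.toContinuousLinearMap e.toLinearMap), 0, fun x _ => by simp⟩
  · exact ⟨l.comp (LinearMap.toContinuousLinearMap e.symm.toLinearMap), 0, fun x _ => by simp⟩

/-! ### Reflexive polytopes from integral polar pairs -/

/-- Two finite sets of integral points whose convex hulls are polar to each other, so that they
define reflexive polytopes. -/
structure IsPolarPair {d : ℕ} (A B : Set (Fin d → ℝ)) : Prop where
  finite_left : A.Finite
  finite_right : B.Finite
  int_left : ∀ a ∈ A, ∀ i, ∃ n : ℤ, a i = n
  int_right : ∀ u ∈ B, ∀ i, ∃ n : ℤ, u i = n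
  zero_left : (0 : Fin d → ℝ) ∈ convexHull ℝ A
  zero_right : (0 : Fin d → ℝ) ∈ convexHull ℝ B
  convexHull_left : convexHull ℝ A = {x | ∀ u ∈ B, -1 ≤ u ⬝ᵥ x}
  active_left : ∀ a ∈ A, ∃ u ∈ B, u ⬝ᵥ a = -1
  active_right : ∀ u ∈ B, ∃ a ∈ A, u ⬝ᵥ a = -1

namespace IsPolarPair

variable {d : ℕ} {A B : Set (Fin d → ℝ)}

theorem symm (h : IsPolarPair A B) : IsPolarPair B A where
  finite_left := h.finite_right
  finite_right := h.finite_left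
  int_left := h.int_right
  int_right := h.int_left
  zero_left := h.zero_right
  zero_right := h.zero_left
  convexHull_left := by
    have := eq_halfspaces_of_dualPolytope_subset h.finite_right h.zero_right
      (B := dotProductEquiv ℝ (Fin d) '' A) ?_ ?_
    · rw [this]
      ext x
      simp
    · rintro _ ⟨a, ha, rfl⟩
      rw [dualPolytope_convexHull]
      intro u hu
      have : a ∈ convexHull ℝ A := subset_convexHull ℝ A ha
      rw [h.convexHull_left] at this
      rw [dotProductEquiv_apply_apply, dotProduct_comm]
      exact this u hu
    · intro Y hY
      obtain ⟨y, rfl⟩ := (dotProductEquiv ℝ (Fin d)).surjective Y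
      have himg := (dotProductEquiv ℝ (Fin d)).toLinearMap.image_convexHull A
      simp only [LinearEquiv.coe_coe] at himg
      rw [← himg, h.convexHull_left]
      rw [dualPolytope_convexHull] at hY
      refine ⟨y, fun u hu => ?_, rfl⟩
      have := hY u hu
      rwa [dotProductEquiv_apply_apply, dotProduct_comm] at this
  active_left u hu := by
    obtain ⟨a, ha, h'⟩ := h.active_right u hu
    exact ⟨a, ha, by rwa [dotProduct_comm]⟩
  active_right a ha := by
    obtain ⟨u, hu, h'⟩ := h.active_left a ha
    exact ⟨u, hu, by rwa [dotProduct_comm]⟩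

/-- In the coordinates of a lattice basis, `L` becomes `ℤ^d` and the dot product identifies integral
vectors with forms in the dual lattice. -/
theorem exists_isReflexivePolytope (h : IsPolarPair A B) {V : Type*} [NormedAddCommGroup V]
    [NormedSpace ℝ V] [FiniteDimensional ℝ V] {L : Submodule ℤ V}
    (b : Module.Basis (Fin d) ℝ V) (hb : Submodule.span ℤ (Set.range b) = L) :
    ∃ P : Set V, IsReflexivePolytope L P ∧ CombinatoriallyIsomorphic P (convexHull ℝ A) := by
  let e : (Fin d → ℝ) ≃ₗ[ℝ] V := b.equivFun.symm
  have hL : ∀ x : Fin d → ℝ, e x ∈ L ↔ ∀ i, ∃ n : ℤ, x i = n := by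
    intro x
    rw [← hb, b.mem_span_iff_repr_mem ℤ]
    have : ∀ i, b.repr (e x) i = x i := fun i => by
      rw [← b.equivFun_apply, LinearEquiv.apply_symm_apply]
    simp [this, eq_comm]
  let φ : (Fin d → ℝ) ≃ₗ[ℝ] Module.Dual ℝ V :=
    (dotProductEquiv ℝ (Fin d)).trans e.symm.dualMap
  have hφ : ∀ u x, φ u (e x) = u ⬝ᵥ x := fun u x => by simp [φ]
  have hφL : ∀ u ∈ B, φ u ∈ dualLattice L := by
    intro u hu x hx
    obtain ⟨x, rfl⟩ := e.surjective x
    rw [hφ]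
    choose m hm using (hL x).1 hx
    choose n hn using h.int_right u hu
    exact ⟨∑ i, n i * m i, by simp [dotProduct, hm, hn]⟩
  have heA : e '' convexHull ℝ A = convexHull ℝ (e '' A) := e.toLinearMap.image_convexHull A
  have hφB : φ '' convexHull ℝ B = convexHull ℝ (φ '' B) := φ.toLinearMap.image_convexHull B
  have hdual : dualPolytope (e '' convexHull ℝ A) = convexHull ℝ (φ '' B) := by
    rw [heA, dualPolytope_convexHull, ← hφB, h.symm.convexHull_left]
    ext y
    obtain ⟨u, rfl⟩ := φ.surjective y
    rw [φ.injective.mem_set_image]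
    simp [hφ, dotProduct_comm u]
  have hneA : A.Nonempty := convexHull_nonempty_iff.1 ⟨0, h.zero_left⟩
  have hneB : B.Nonempty := convexHull_nonempty_iff.1 ⟨0, h.zero_right⟩
  have hext : (e '' convexHull ℝ A).extremePoints ℝ ⊆ e '' A := by
    rw [heA]
    exact extremePoints_convexHull_subset
  refine ⟨e '' convexHull ℝ A, ⟨⟨⟨⟨e '' A, h.finite_left.image e, hneA.image e, heA⟩, ?_⟩, ?_, ?_⟩,
    ⟨φ '' B, h.finite_right.image φ, hneB.image φ, hdual⟩, ?_⟩,
    (combinatoriallyIsomorphic_image_linearEquiv e _).symm⟩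
  · intro v hv
    obtain ⟨a, ha, rfl⟩ := hext hv
    exact (hL a).2 (h.int_left a ha)
  · rw [mem_interior]
    refine ⟨⋂ u ∈ B, {v | -1 < φ u v}, fun v hv => ?_, ?_, ?_⟩
    · obtain ⟨x, rfl⟩ := e.surjective v
      rw [e.injective.mem_set_image, h.convexHull_left]
      intro u hu
      have := Set.mem_iInter₂.1 hv u hu
      rw [Set.mem_ofPred_eq, hφ] at this
      exact this.le
    · exact h.finite_right.isOpen_biInter fun u _ =>
        isOpen_lt continuous_const (LinearMap.continuous_of_finiteDimensional (φ u))
    · simp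
  · intro v hv
    obtain ⟨a, ha, rfl⟩ := hext hv
    obtain ⟨u, hu, hua⟩ := h.active_left a ha
    refine ⟨(hL a).2 (h.int_left a ha), fun h0 => ?_, fun w hw n hn => ?_⟩
    · have := hφ u a
      rw [h0, map_zero, hua] at this
      norm_num at this
    -- Primitivity: a form of the dual lattice is `-1` at the vertex `n • w`, so `n` divides 1.
    · obtain ⟨m, hm⟩ := hφL u hu w hw
      have h1 := hφ u a
      rw [hn, map_nsmul, hua, hm, nsmul_eq_mul] at h1
      have h2 : (n : ℤ) * m = -1 := by exact_mod_cast h1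
      have h3 : (n : ℤ) ∣ 1 := ⟨-m, by linarith⟩
      exact Nat.dvd_one.1 (by exact_mod_cast h3)
  · rw [hdual]
    intro y hy
    obtain ⟨u, hu, rfl⟩ := extremePoints_convexHull_subset hy
    exact hφL u hu

end IsPolarPair

/-! ### The cube and the crosspolytope -/

/-- The vertices `±1` of the cube. -/
def cubeVertices (d : ℕ) : Set (Fin d → ℝ) := Set.univ.pi fun _ => {-1, 1}

/-- The vertices `±e_i` of the crosspolytope. -/
def crossVertices (d : ℕ) : Set (Fin d → ℝ) :=
  {x | ∃ i, x = Pi.single i 1} ∪ {x | ∃ i, x = -Pi.single i 1}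

theorem convexHull_cubeVertices (d : ℕ) : convexHull ℝ (cubeVertices d) = cubePolytope d := by
  rw [cubeVertices, convexHull_pi, cubePolytope, ← Set.pi_univ_Icc]
  congr 1
  ext i : 1
  rw [convexHull_pair, segment_eq_Icc (by norm_num)]

theorem isPolarPair_cube {d : ℕ} (hd : 1 ≤ d) : IsPolarPair (cubeVertices d) (crossVertices d) := by
  have hcube : ∀ a ∈ cubeVertices d, ∀ i, a i = -1 ∨ a i = 1 := fun a ha i => ha i trivial
  have i₀ : Fin d := ⟨0, hd⟩
  refine ⟨Set.Finite.pi fun _ => by simp, ?_, fun a ha i => ?_, ?_, ?_, ?_, ?_, fun a ha => ?_, ?_⟩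
  · refine Set.Finite.union ?_ ?_
    · exact (Set.finite_range fun i : Fin d => (Pi.single i 1 : Fin d → ℝ)).subset
        fun x ⟨i, hi⟩ => ⟨i, hi.symm⟩
    · exact (Set.finite_range fun i : Fin d => -(Pi.single i 1 : Fin d → ℝ)).subset
        fun x ⟨i, hi⟩ => ⟨i, hi.symm⟩
  · rcases hcube a ha i with h | h
    · exact ⟨-1, by simp [h]⟩
    · exact ⟨1, by simp [h]⟩
  · rintro _ (⟨j, rfl⟩ | ⟨j, rfl⟩) i
    · exact ⟨if i = j then 1 else 0, by simp [Pi.single_apply]⟩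
    · exact ⟨-if i = j then 1 else 0, by simp [Pi.single_apply]⟩
  · rw [convexHull_cubeVertices, cubePolytope]
    exact ⟨fun i => by simp, fun i => by simp⟩
  · have h1 : (Pi.single i₀ 1 : Fin d → ℝ) ∈ crossVertices d := Or.inl ⟨i₀, rfl⟩
    have h2 : -(Pi.single i₀ 1 : Fin d → ℝ) ∈ crossVertices d := Or.inr ⟨i₀, rfl⟩
    have := (convex_convexHull ℝ (crossVertices d)) (subset_convexHull ℝ _ h1)
      (subset_convexHull ℝ _ h2) (a := 1 / 2) (b := 1 / 2) (by norm_num) (by norm_num)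
      (by norm_num)
    simpa using this
  · rw [convexHull_cubeVertices]
    ext x
    constructor
    · rintro ⟨h1, h2⟩ _ (⟨i, rfl⟩ | ⟨i, rfl⟩)
      · simpa using h1 i
      · simpa using h2 i
    · intro h
      refine ⟨fun i => ?_, fun i => ?_⟩
      · simpa using h _ (Or.inl ⟨i, rfl⟩)
      · simpa using h _ (Or.inr ⟨i, rfl⟩)
  · rcases hcube a ha i₀ with h | h
    · exact ⟨_, Or.inl ⟨i₀, rfl⟩, by simp [h]⟩
    · exact ⟨_, Or.inr ⟨i₀, rfl⟩, by simp [h]⟩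
  · rintro _ (⟨i, rfl⟩ | ⟨i, rfl⟩)
    · exact ⟨fun _ => -1, fun _ _ => by simp, by simp⟩
    · exact ⟨fun _ => 1, fun _ _ => by simp, by simp⟩

/-! ### The simplex and its polar -/

/-- The projection of `ℝ^(d+1)` along the diagonal onto `ℝ^d`. -/
def simplexProj (d : ℕ) : (Fin (d + 1) → ℝ) →ₗ[ℝ] (Fin d → ℝ) where
  toFun x i := x i.succ - x 0
  map_add' x y := by
    ext i
    simp only [Pi.add_apply]
    ring
  map_smul' c x := by
    ext i
    simp only [Pi.smul_apply, smul_eq_mul, RingHom.id_apply]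
    ring

theorem simplexProj_apply {d : ℕ} (x : Fin (d + 1) → ℝ) (i : Fin d) :
    simplexProj d x i = x i.succ - x 0 := rfl

theorem sum_succ_of_mem_stdSimplex {d : ℕ} {x : Fin (d + 1) → ℝ}
    (hx : x ∈ stdSimplex ℝ (Fin (d + 1))) : ∑ i : Fin d, x i.succ = 1 - x 0 := by
  have := hx.2
  rw [Fin.sum_univ_succ] at this
  linarith

theorem sum_simplexProj {d : ℕ} {x : Fin (d + 1) → ℝ} (hx : x ∈ stdSimplex ℝ (Fin (d + 1))) :
    ∑ i, simplexProj d x i = 1 - (d + 1) * x 0 := by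
  simp only [simplexProj_apply, Finset.sum_sub_distrib, sum_succ_of_mem_stdSimplex hx,
    Finset.sum_const, Finset.card_univ, Fintype.card_fin, nsmul_eq_mul]
  ring

/-- The vertices `e_1, …, e_d, -e_1 - ⋯ - e_d` of a reflexive simplex. -/
def simplexVertices (d : ℕ) : Set (Fin d → ℝ) :=
  simplexProj d '' Set.range fun i => Pi.single i 1

theorem convexHull_simplexVertices (d : ℕ) :
    convexHull ℝ (simplexVertices d) = simplexProj d '' simplexPolytope d := by
  rw [simplexVertices, ← LinearMap.image_convexHull, convexHull_rangle_single_eq_stdSimplex]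
  rfl

/-- The vertices of the polar of the reflexive simplex. -/
def simplexPolarVertices (d : ℕ) : Set (Fin d → ℝ) :=
  Set.range (Fin.cons (-1) fun i => (d + 1 : ℝ) • Pi.single i 1 - 1 : Fin (d + 1) → Fin d → ℝ)

theorem forall_mem_simplexPolarVertices {d : ℕ} {p : (Fin d → ℝ) → Prop} :
    (∀ u ∈ simplexPolarVertices d, p u) ↔
      p (-1) ∧ ∀ i, p ((d + 1 : ℝ) • Pi.single i 1 - 1) := by
  rw [simplexPolarVertices, Set.forall_mem_range, Fin.forall_fin_succ]
  simp

theorem forall_mem_simplexVertices {d : ℕ} {p : (Fin d → ℝ) → Prop} :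
    (∀ a ∈ simplexVertices d, p a) ↔ p (-1) ∧ ∀ i, p (Pi.single i 1) := by
  have h0 : simplexProj d (Pi.single 0 1) = -1 := by
    ext i; simp [simplexProj_apply]
  have h1 : ∀ j, simplexProj d (Pi.single j.succ 1) = Pi.single j 1 := by
    intro j
    ext i
    simp [simplexProj_apply, Pi.single_apply]
  rw [simplexVertices, Set.forall_mem_image, Set.forall_mem_range, Fin.forall_fin_succ, h0]
  simp only [h1]

/-- If `x` is the projection of `z` in the standard simplex, the polar vertices take the values `(d
+ 1) * z j - 1` at `x`. The half-spaces thus say that the barycentric coordinates are non-negative.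
-/
theorem isPolarPair_simplex {d : ℕ} (hd : 1 ≤ d) :
    IsPolarPair (simplexVertices d) (simplexPolarVertices d) := by
  have i₀ : Fin d := ⟨0, hd⟩
  have hd0 : (0 : ℝ) < d + 1 := by positivity
  have hAmem : (-1 : Fin d → ℝ) ∈ simplexVertices d ∧ ∀ i, Pi.single i 1 ∈ simplexVertices d :=
    forall_mem_simplexVertices.1 fun _ h => h
  have hBmem := (forall_mem_simplexPolarVertices (d := d)).1 fun _ h => h
  have hhull : convexHull ℝ (simplexVertices d) =
      {x | ∀ u ∈ simplexPolarVertices d, -1 ≤ u ⬝ᵥ x} := by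
    rw [convexHull_simplexVertices]
    ext x
    rw [Set.mem_ofPred_eq, forall_mem_simplexPolarVertices]
    have hdot : (-1 : Fin d → ℝ) ⬝ᵥ x = -∑ i, x i := by simp [dotProduct]
    have hdot' : ∀ i, ((d + 1 : ℝ) • Pi.single i 1 - 1 : Fin d → ℝ) ⬝ᵥ x =
        (d + 1) * x i - ∑ j, x j := fun i => by
      rw [sub_eq_add_neg, add_dotProduct, hdot, smul_dotProduct, single_one_dotProduct,
        smul_eq_mul, sub_eq_add_neg]
    simp only [hdot, hdot']
    constructor
    · rintro ⟨z, hz, rfl⟩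
      rw [sum_simplexProj hz]
      have h0 := mul_nonneg hd0.le (hz.1 0)
      refine ⟨by linarith, fun i => ?_⟩
      have h1 := mul_nonneg hd0.le (hz.1 i.succ)
      rw [simplexProj_apply]
      linarith
    · rintro ⟨h1, h2⟩
      -- The barycentric coordinate `z 0` is recovered from `∑ x i = 1 - (d + 1) * z 0`.
      set t := (1 - ∑ i, x i) / (d + 1 : ℝ) with ht
      have htm : (d + 1) * t = 1 - ∑ i, x i := by rw [ht]; field_simp
      refine ⟨Fin.cons t fun i => x i + t, ⟨fun i => ?_, ?_⟩, ?_⟩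
      · refine Fin.cases ?_ (fun i => ?_) i
        · exact div_nonneg (by linarith) hd0.le
        · rw [Fin.cons_succ]
          refine nonneg_of_mul_nonneg_right (a := (d + 1 : ℝ)) ?_ hd0
          have := h2 i
          rw [mul_add, htm]
          linarith
      · rw [Fin.sum_univ_succ]
        simp only [Fin.cons_zero, Fin.cons_succ, Finset.sum_add_distrib, Finset.sum_const,
          Finset.card_univ, Fintype.card_fin, nsmul_eq_mul]
        linarith
      · ext i
        simp [simplexProj_apply]
  refine ⟨(Set.finite_range _).image _, Set.finite_range _, ?_, ?_, ?_, ?_, hhull, ?_, ?_⟩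
  · rw [forall_mem_simplexVertices]
    exact ⟨fun i => ⟨-1, by simp⟩, fun j i => ⟨if i = j then 1 else 0, by simp [Pi.single_apply]⟩⟩
  · rw [forall_mem_simplexPolarVertices]
    exact ⟨fun i => ⟨-1, by simp⟩, fun j i =>
      ⟨(d + 1) * (if i = j then 1 else 0) - 1, by simp [Pi.single_apply]⟩⟩
  · rw [hhull]
    intro u _
    simp
  -- The `d + 1` polar vertices have barycenter 0.
  · have := (convex_convexHull ℝ (simplexPolarVertices d)).sum_mem (t := Finset.univ)
      (w := fun _ : Fin (d + 1) => (d + 1 : ℝ)⁻¹)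
      (z := Fin.cons (-1) fun i => (d + 1 : ℝ) • Pi.single i 1 - 1) (fun _ _ => by positivity)
      (by simp; field_simp) (fun i _ => subset_convexHull ℝ _ ⟨i, rfl⟩)
    convert this
    ext j
    rw [← Finset.smul_sum, Fin.sum_univ_succ]
    simp [Finset.sum_apply, Pi.single_apply]
  · rw [forall_mem_simplexVertices]
    refine ⟨⟨_, hBmem.2 i₀, ?_⟩, fun i => ⟨_, hBmem.1, by simp⟩⟩
    simp [dotProduct, Pi.single_apply]
  · rw [forall_mem_simplexPolarVertices]
    refine ⟨⟨_, hAmem.2 i₀, by simp⟩, fun i => ⟨_, hAmem.1, ?_⟩⟩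
    simp [dotProduct, Pi.single_apply]

/-- The coordinate sum is 1 on the simplex, so the projection is injective there and forms matter
only up to multiples of this sum. -/
theorem combinatoriallyIsomorphic_simplexVertices (d : ℕ) :
    CombinatoriallyIsomorphic (convexHull ℝ (simplexVertices d)) (simplexPolytope d) := by
  rw [convexHull_simplexVertices]
  refine (combinatoriallyIsomorphic_image _ ?_ (fun l => ?_) fun l => ?_).symm
  · intro x hx y hy he
    have h0 : x 0 = y 0 := by
      have h := sum_simplexProj hx
      rw [he, sum_simplexProj hy] at h
      have : (d + 1 : ℝ) * x 0 = (d + 1) * y 0 := by linarith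
      exact mul_left_cancel₀ (by positivity) this
    ext i
    refine Fin.cases h0 (fun i => ?_) i
    have := congrFun he i
    rw [simplexProj_apply, simplexProj_apply, h0] at this
    linarith
  · exact ⟨l.comp (LinearMap.toContinuousLinearMap (simplexProj d)), 0, fun x _ => by simp⟩
  · set g : Fin (d + 1) → ℝ := fun j => l (Pi.single j 1) with hg
    -- Subtracting the mean `t` makes the form vanish on the diagonal, the kernel of the projection,
    -- and changes it by the constant `t` on the simplex.
    set t : ℝ := (∑ j, g j) / (d + 1) with ht
    have htm : (d + 1) * t = g 0 + ∑ i : Fin d, g i.succ := by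
      rw [← Fin.sum_univ_succ, ht]; field_simp
    refine ⟨LinearMap.toContinuousLinearMap (dotProductEquiv ℝ (Fin d) fun i => g i.succ - t), -t,
      fun x hx => ?_⟩
    have hlx : l x = ∑ j, x j * g j := by
      conv_lhs => rw [← Finset.univ_sum_single x, map_sum]
      refine Finset.sum_congr rfl fun j _ => ?_
      rw [hg, ← smul_eq_mul, ← map_smul, ← Pi.single_smul, smul_eq_mul, mul_one]
    rw [hlx, Fin.sum_univ_succ, LinearMap.coe_toContinuousLinearMap', dotProductEquiv_apply_apply]
    have h1 := sum_succ_of_mem_stdSimplex hx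
    have h2 : (fun i => g (Fin.succ i) - t) ⬝ᵥ simplexProj d x =
        ∑ i : Fin d, x i.succ * g i.succ - x 0 * ∑ i : Fin d, g i.succ
          - t * ∑ i : Fin d, x i.succ + d * (t * x 0) := by
      have h3 : (d : ℝ) * (t * x 0) = ∑ _i : Fin d, t * x 0 := by simp
      rw [h3, Finset.mul_sum, Finset.mul_sum, ← Finset.sum_sub_distrib, ← Finset.sum_sub_distrib,
        ← Finset.sum_add_distrib]
      refine Finset.sum_congr rfl fun i _ => ?_
      rw [simplexProj_apply]
      ring
    rw [h2, h1]
    linear_combination x 0 * htm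

/-! ### The main theorem -/

theorem corollary3p4 {V : Type*} [NormedAddCommGroup V] [NormedSpace ℝ V]
    [FiniteDimensional ℝ V] (L : Submodule ℤ V) [DiscreteTopology L] [IsZLattice ℝ L]
    (d : ℕ) (hd : 1 ≤ d) (hdim : Module.finrank ℝ V = d) :
    (∃ P : Set V, IsReflexivePolytope L P ∧ CombinatoriallyIsomorphic P (simplexPolytope d)) ∧
    (∃ P : Set V, IsReflexivePolytope L P ∧ CombinatoriallyIsomorphic P (cubePolytope d)) ∧
    (∃ P : Set V, IsReflexivePolytope L P ∧ CombinatoriallyIsomorphic P (crossPolytope d)) ∧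
    (d = 3 → ¬ ∃ P : Set V, IsReflexivePolytope L P ∧ CombinatoriallyIsomorphic P dodecahedron) ∧
    (d = 3 → ¬ ∃ P : Set V, IsReflexivePolytope L P ∧ CombinatoriallyIsomorphic P icosahedron) ∧
    (d = 4 → ¬ ∃ P : Set V, IsReflexivePolytope L P ∧ CombinatoriallyIsomorphic P cell120) ∧
    (d = 4 → ¬ ∃ P : Set V, IsReflexivePolytope L P ∧ CombinatoriallyIsomorphic P cell600) := by
  have : Nontrivial V := Module.nontrivial_of_finrank_pos (R := ℝ) (by omega)
  have : Module.Free ℤ L := ZLattice.module_free ℝ L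
  have : Module.Finite ℤ L := ZLattice.module_finite ℝ L
  let b₀ := (Module.Free.chooseBasis ℤ L).ofZLatticeBasis ℝ L
  let b := b₀.reindex (Fintype.equivFinOfCardEq ((Module.finrank_eq_card_basis b₀).symm.trans hdim))
  have hb : Submodule.span ℤ (Set.range b) = L := by
    rw [Module.Basis.range_reindex]
    exact (Module.Free.chooseBasis ℤ L).ofZLatticeBasis_span ℝ
  obtain ⟨X, α, β, hX, hXe, hXc⟩ := exists_isSimplicialSystem_icosahedron
  obtain ⟨Y, α', β', hY, hYe, hYc⟩ := exists_isSimplicialSystem_cell600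
  refine ⟨?_, ?_, (isPolarPair_cube hd).symm.exists_isReflexivePolytope b hb, ?_, ?_, ?_, ?_⟩
  · obtain ⟨P, hP, hiso⟩ := (isPolarPair_simplex hd).exists_isReflexivePolytope b hb
    exact ⟨P, hP, hiso.trans (combinatoriallyIsomorphic_simplexVertices d)⟩
  · rw [← convexHull_cubeVertices]
    exact (isPolarPair_cube hd).exists_isReflexivePolytope b hb
  · rintro rfl ⟨P, hP, hiso⟩
    rw [dodecahedron, ← hXe] at hiso
    exact hX.not_combinatoriallyIsomorphic_euclideanPolar hdim hXc hP hiso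
  · rintro rfl ⟨P, hP, hiso⟩
    rw [icosahedron, ← hXe] at hiso
    exact hX.not_combinatoriallyIsomorphic_convexHull hdim hXc hP hiso
  · rintro rfl ⟨P, hP, hiso⟩
    rw [cell120, ← hYe] at hiso
    exact hY.not_combinatoriallyIsomorphic_euclideanPolar hdim hYc hP hiso
  · rintro rfl ⟨P, hP, hiso⟩
    rw [cell600, ← hYe] at hiso
    exact hY.not_combinatoriallyIsomorphic_convexHull hdim hYc hP hiso
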